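/- Let $\mathbb{C}\{t\}$ be the ring of convergent power series, $K=\mathbb{C}\{t\}[1/t]$ its field of fractions, and let $(\widetilde M,\theta)$ be a germ of meromorphic Higgs bundle, that is, a finite dimensional $K$-vector space $\widetilde M$ with a $K$-linear endomorphism $\theta$. For $q\ge 1$ let $K_q=\mathbb{C}\{t_q\}[1/t_q]\supseteq K$ with $t_q^q=t$, let $\widetilde M_q=K_q\otimes_K\widetilde M$, and let $\theta_q=q\,t_q^{q-1}(1\otimes\theta)$ be the pull-back of $\theta$ as a differential form $\theta\,dt$. A Higgs field $\theta$ on a finite dimensional vector space over $K$ (resp. $K_q$) is called regular if $t\theta$ (resp. $t_q\theta$) preserves some lattice, where a lattice of a vector space $V$ is a finitely generated $\mathbb{C}\{t\}$-submodule $E$ (resp. $\mathbb{C}\{t_q\}$-submodule) such that $E[1/t]=V$ (resp. $E[1/t_q]=V$). Then there is a unique decomposition $\widetilde M=\widetilde M^{\mathrm{reg}}\oplus\widetilde M^{\mathrm{irr}}$ into $\theta$-stable subspaces with the following property: for some $q\ge1$ there is a finite direct sum decomposition $\widetilde M_q=\bigoplus_{\varphi}N_\varphi$, indexed by elements $\varphi\in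 t_q^{-1}\mathbb{C}[t_q^{-1}]$, into $\theta_q$-stable $K_q$-subspaces such that $\theta_q-\frac{\partial\varphi}{\partial t_q}$ is regular on $N_\varphi$ for every $\varphi$, and such that $K_q\otimes_K\widetilde M^{\mathrm{reg}}=N_0$ and $K_q\otimes_K\widetilde M^{\mathrm{irr}}=\bigoplus_{\varphi\ne0}N_\varphi$. The subspace $\widetilde M^{\mathrm{reg}}$ is called the regular part of $(\widetilde M,\theta)$. For any $V_0$-lattice $U$ of $\widetilde M$, i.e. any finitely generated $\mathbb{C}\{t\}[t\theta]$-submodule $U\subseteq\widetilde M$ with $U[1/t]=\widetilde M$, the space $U/tU$ is finite dimensional over $\mathbb{C}$ and $$\dim_{\mathbb{C}}U/tU=\dim_K\widetilde M^{\mathrm{reg}}.$$ -/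

import Mathlib

open scoped TensorProduct Polynomial

noncomputable section

namespace MeromorphicHiggs

lemma summable_mono {f : PowerSeries ℂ} {r s : ℝ} (hr : 0 ≤ r) (hrs : r ≤ s)
    (h : Summable fun n => ‖PowerSeries.coeff n f‖ * s ^ n) :
    Summable fun n => ‖PowerSeries.coeff n f‖ * r ^ n :=
  Summable.of_nonneg_of_le (fun n => by positivity) (fun n => by gcongr) h

/-- The ring `ℂ{t}` of power series with a positive radius of convergence. -/
def convergentSeries : Subalgebra ℂ (PowerSeries ℂ) where
  carrier := {f | ∃ r : ℝ, 0 < r ∧ Summable fun n => ‖PowerSeries.coeff n f‖ * r ^ n}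
  mul_mem' := by
    rintro f g ⟨r, hr, hf⟩ ⟨s, hs, hg⟩
    have hm : 0 < min r s := lt_min hr hs
    refine ⟨min r s, hm, ?_⟩
    have hf' := summable_mono hm.le (min_le_left r s) hf
    have hg' := summable_mono hm.le (min_le_right r s) hg
    have key := summable_norm_sum_mul_antidiagonal_of_summable_norm
      (f := fun n => PowerSeries.coeff n f * ((min r s : ℝ) : ℂ) ^ n)
      (g := fun n => PowerSeries.coeff n g * ((min r s : ℝ) : ℂ) ^ n)
      (by simpa [abs_of_pos hm] using hf') (by simpa [abs_of_pos hm] using hg')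
    refine key.congr fun n => ?_
    have : ∑ kl ∈ Finset.HasAntidiagonal.antidiagonal n,
        PowerSeries.coeff kl.1 f * ((min r s : ℝ) : ℂ) ^ kl.1 *
          (PowerSeries.coeff kl.2 g * ((min r s : ℝ) : ℂ) ^ kl.2) =
        PowerSeries.coeff n (f * g) * ((min r s : ℝ) : ℂ) ^ n := by
      rw [PowerSeries.coeff_mul, Finset.sum_mul]
      refine Finset.sum_congr rfl fun kl hkl => ?_
      rw [← Finset.HasAntidiagonal.mem_antidiagonal.1 hkl, pow_add]
      ring
    rw [this, norm_mul, norm_pow, Complex.norm_real, Real.norm_of_nonneg hm.le]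
  add_mem' := by
    rintro f g ⟨r, hr, hf⟩ ⟨s, hs, hg⟩
    have hm : 0 < min r s := lt_min hr hs
    refine ⟨min r s, hm, ?_⟩
    have hf' := summable_mono hm.le (min_le_left r s) hf
    have hg' := summable_mono hm.le (min_le_right r s) hg
    refine Summable.of_nonneg_of_le (fun n => by positivity) (fun n => ?_) (hf'.add hg')
    rw [← add_mul, map_add]
    gcongr
    exact norm_add_le _ _
  algebraMap_mem' := by
    intro c
    refine ⟨1, one_pos, summable_of_ne_finset_zero (s := {0}) fun n hn => ?_⟩
    have hn' : n ≠ 0 := by simpa using hn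
    simp [PowerSeries.coeff_C, hn']

/-- `ℂ{t}` as a type. -/
def ConvSeries : Type := ↥convergentSeries

instance : CommRing ConvSeries := inferInstanceAs (CommRing convergentSeries)

instance : IsDomain ConvSeries := inferInstanceAs (IsDomain convergentSeries)

instance : Algebra ℂ ConvSeries := inferInstanceAs (Algebra ℂ convergentSeries)

/-- The coordinate `t`, as an element of `ℂ{t}`. -/
def tvar : ConvSeries :=
  (⟨PowerSeries.X, 1, one_pos, summable_of_ne_finset_zero (s := {1}) fun n hn => by
    have hn' : n ≠ 1 := by simpa using hn
    simp [PowerSeries.coeff_X, hn']⟩ : convergentSeries)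

/-- The field `K` of convergent Laurent series: as `ℂ{t}` is a discrete valuation ring with
uniformizer `t`, the field `K = ℂ{t}[1/t]` is the fraction field of `ℂ{t}`. -/
def ConvLaurent : Type := FractionRing ConvSeries

instance : Field ConvLaurent := inferInstanceAs (Field (FractionRing ConvSeries))

instance : Algebra ConvSeries ConvLaurent :=
  inferInstanceAs (Algebra ConvSeries (FractionRing ConvSeries))

instance : IsFractionRing ConvSeries ConvLaurent :=
  inferInstanceAs (IsFractionRing ConvSeries (FractionRing ConvSeries))

instance : Algebra ℂ ConvLaurent := inferInstanceAs (Algebra ℂ (FractionRing ConvSeries))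

instance : IsScalarTower ℂ ConvSeries ConvLaurent :=
  inferInstanceAs (IsScalarTower ℂ ConvSeries (FractionRing ConvSeries))

/-- The substitution `f(t) ↦ f(t ^ q)` on `ℂ{t}`. -/
def ramify (q : ℕ) [NeZero q] : ConvSeries →+* ConvSeries :=
  show convergentSeries →+* convergentSeries from
  (((PowerSeries.expand q (NeZero.ne q) : PowerSeries ℂ →ₐ[ℂ] PowerSeries ℂ).comp
    convergentSeries.val).codRestrict convergentSeries (by
      rintro ⟨f, r, hr, hf⟩
      have hq : (q : ℝ) ≠ 0 := Nat.cast_ne_zero.2 (NeZero.ne q)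
      refine ⟨r ^ ((q : ℝ)⁻¹), Real.rpow_pos_of_pos hr _, ?_⟩
      have hinj : Function.Injective fun n : ℕ => q * n :=
        fun _ _ h => Nat.eq_of_mul_eq_mul_left (NeZero.pos q) h
      refine (hinj.summable_iff fun n hn => ?_).1 (hf.congr fun n => ?_)
      · have : ¬ q ∣ n := fun ⟨m, hm⟩ => hn ⟨m, hm.symm⟩
        simp [PowerSeries.coeff_expand_of_not_dvd q (NeZero.ne q) f this]
      · have : (r ^ ((q : ℝ)⁻¹)) ^ q = r := Real.rpow_inv_natCast_pow hr.le (NeZero.ne q)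
        simp [PowerSeries.coeff_expand_mul q (NeZero.ne q), pow_mul, this])).toRingHom

lemma ramify_injective (q : ℕ) [NeZero q] : Function.Injective (ramify q) := by
  intro f g h
  refine Subtype.ext (PowerSeries.ext fun n => ?_)
  have h' : PowerSeries.coeff (q * n) (PowerSeries.expand q (NeZero.ne q) f.1) =
      PowerSeries.coeff (q * n) (PowerSeries.expand q (NeZero.ne q) g.1) :=
    congrArg (fun f : convergentSeries => PowerSeries.coeff (q * n) f.1) h
  simpa [PowerSeries.coeff_expand_mul q (NeZero.ne q)] using h'

/-- The field `K_q = ℂ{t_q}[1/t_q]`, where `t_q ^ q = t`: a copy of `K` whose coordinate is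
written `t_q`, and which is an extension of `K` through `f(t) ↦ f(t_q ^ q)`. -/
def RamifiedField (_q : ℕ) : Type := ConvLaurent

section RamifiedField

variable (q : ℕ)

instance : Field (RamifiedField q) := inferInstanceAs (Field ConvLaurent)

/-- `K_q` as an algebra over `ℂ{t_q}`; the distinguished coordinate `tvar` acts as `t_q`. -/
instance : Algebra ConvSeries (RamifiedField q) :=
  inferInstanceAs (Algebra ConvSeries ConvLaurent)

instance : Algebra ℂ (RamifiedField q) := inferInstanceAs (Algebra ℂ ConvLaurent)

instance : IsScalarTower ℂ ConvSeries (RamifiedField q) :=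
  inferInstanceAs (IsScalarTower ℂ ConvSeries ConvLaurent)

instance : IsFractionRing ConvSeries (RamifiedField q) :=
  inferInstanceAs (IsFractionRing ConvSeries ConvLaurent)

/-- `K_q` as an extension of `K`, through `f(t) ↦ f(t_q ^ q)`. -/
instance [NeZero q] : Algebra ConvLaurent (RamifiedField q) :=
  (IsFractionRing.map (A := ConvSeries) (B := ConvSeries) (K := ConvLaurent) (L := ConvLaurent)
    (ramify_injective q)).toAlgebra

instance [NeZero q] : SMulCommClass ConvLaurent ConvSeries (RamifiedField q) where
  smul_comm a b x := by
    rw [Algebra.smul_def, Algebra.smul_def, Algebra.smul_def, Algebra.smul_def, mul_left_comm]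

/-- The coordinate `t_q` as an element of `K_q`. -/
def tq : RamifiedField q := algebraMap ConvSeries (RamifiedField q) tvar

end RamifiedField

section Regular

/-- A lattice `E` of a vector space `V` over `F = ℂ{t}[1/t]`: a `ℂ{t}`-submodule of finite type
with `E[1/t] = V`. -/
structure IsLattice {V : Type*} [AddCommGroup V] [Module ConvSeries V]
    (E : Submodule ConvSeries V) : Prop where
  fg : E.FG
  exists_pow_smul_mem : ∀ v : V, ∃ n : ℕ, tvar ^ n • v ∈ E

/-- A Higgs field `θ` is regular if it has at most a simple pole on some lattice `E`, that is
`tθ(E) ⊆ E`. Here `F` is the field `ℂ{t}[1/t]`, that is `K` or one of its copies `K_q`. -/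
def IsRegular {F V : Type*} [Field F] [AddCommGroup V] [Module ConvSeries V] [Module F V]
    (θ : Module.End F V) : Prop :=
  ∃ E : Submodule ConvSeries V, IsLattice E ∧ ∀ e ∈ E, tvar • θ e ∈ E

end Regular

section Decomposition

/-- The polar parts `φ ∈ t_q⁻¹ ℂ[t_q⁻¹]`, written as polynomials without constant term in the
variable `X = t_q⁻¹`. -/
abbrev PolarPart : Type := ↥(Ideal.span {(Polynomial.X : ℂ[X])})

/-- The derivative `∂φ/∂t_q ∈ K_q` of a polar part `φ = P(t_q⁻¹)`,
namely `- t_q⁻² P'(t_q⁻¹)`. -/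
def PolarPart.deriv (q : ℕ) (φ : PolarPart) : RamifiedField q :=
  -((tq q)⁻¹ ^ 2 * Polynomial.aeval (tq q)⁻¹ (Polynomial.derivative (φ : ℂ[X])))

variable {M : Type*} [AddCommGroup M] [Module ConvLaurent M]

/-- The pull-back `M_q = K_q ⊗_K M`. -/
abbrev Pullback (q : ℕ) [NeZero q] (M : Type*) [AddCommGroup M] [Module ConvLaurent M] : Type _ :=
  RamifiedField q ⊗[ConvLaurent] M

/-- The pull-back `θ_q` of `θ` as a differential form: as `dt = q t_q ^ (q - 1) dt_q`, it is
`q t_q ^ (q - 1) (1 ⊗ θ)`. -/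
def pullbackField (q : ℕ) [NeZero q] (θ : Module.End ConvLaurent M) :
    Module.End (RamifiedField q) (Pullback q M) :=
  ((q : RamifiedField q) * tq q ^ (q - 1)) • θ.baseChange (RamifiedField q)

/-- The Higgs field `θ_q - ∂φ/∂t_q` of `ℰ^{-φ} ⊗ (M_q, θ_q)`. -/
def twistedField (q : ℕ) [NeZero q] (θ : Module.End ConvLaurent M) (φ : PolarPart) :
    Module.End (RamifiedField q) (Pullback q M) :=
  pullbackField q θ - φ.deriv q • (1 : Module.End (RamifiedField q) (Pullback q M))

/-- A decomposition `(M_q, θ_q) = ⨁_φ (ℰ^φ ⊗ R_φ)` with `R_φ` regular, where `φ` runs in a finite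
set of polar parts. The summand `ℰ^φ ⊗ R_φ` is a `θ_q`-stable subspace `N φ`; as the Higgs field of
`ℰ^φ` is `dφ`, the Higgs field of `R_φ` is `θ_q - ∂φ/∂t_q` on `N φ`. -/
structure IsPolarDecomposition (q : ℕ) [NeZero q] (θ : Module.End ConvLaurent M)
    (N : PolarPart → Submodule (RamifiedField q) (Pullback q M)) : Prop where
  finite : {φ | N φ ≠ ⊥}.Finite
  iSupIndep : iSupIndep N
  iSup_eq_top : ⨆ φ, N φ = ⊤
  regular : ∀ φ, ∃ h : ∀ x ∈ N φ, twistedField q θ φ x ∈ N φ,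
    IsRegular (F := RamifiedField q) (V := N φ) ((twistedField q θ φ).restrict h)

/-- `(M, θ) = (Mreg, θ) ⊕ (Mirr, θ)` is the decomposition of `(M, θ)` into its regular part and its
purely irregular part: after some ramification `t = t_q ^ q`, the subspace `K_q ⊗ Mreg` becomes the
summand `φ = 0`, and `K_q ⊗ Mirr` the sum of the summands `φ ≠ 0`, of a decomposition
`(M_q, θ_q) = ⨁_φ (ℰ^φ ⊗ R_φ)`. -/
structure IsRegIrrDecomposition (θ : Module.End ConvLaurent M)
    (Mreg Mirr : Submodule ConvLaurent M) : Prop where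
  map_reg : ∀ m ∈ Mreg, θ m ∈ Mreg
  map_irr : ∀ m ∈ Mirr, θ m ∈ Mirr
  isCompl : IsCompl Mreg Mirr
  ramified : ∃ (q : ℕ) (_ : NeZero q)
    (N : PolarPart → Submodule (RamifiedField q) (Pullback q M)),
      IsPolarDecomposition q θ N ∧
      Mreg.baseChange (RamifiedField q) = N 0 ∧
      Mirr.baseChange (RamifiedField q) = ⨆ φ ≠ 0, N φ

end Decomposition

section V0

variable {M : Type*} [AddCommGroup M] [Module ConvLaurent M] [Module ConvSeries M]
  [IsScalarTower ConvSeries ConvLaurent M]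

/-- The ring `ℂ{t}[tθ]` of endomorphisms of `M`. -/
abbrev V0 (θ : Module.End ConvLaurent M) : Subalgebra ConvSeries (Module.End ConvLaurent M) :=
  Algebra.adjoin ConvSeries {tvar • θ}

/-- A `V₀`-lattice: a `ℂ{t}[tθ]`-submodule `U` of finite type with `U[1/t] = M`. -/
structure IsV0Lattice (θ : Module.End ConvLaurent M) (U : Submodule (V0 θ) M) : Prop where
  fg : U.FG
  exists_pow_smul_mem : ∀ m : M, ∃ n : ℕ, tvar ^ n • m ∈ U

/-- The `ℂ`-vector space `U / tU`. -/
abbrev V0Quotient (θ : Module.End ConvLaurent M) (U : Submodule (V0 θ) M) : Type _ :=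
  RestrictScalars ℂ ConvSeries
    (U.restrictScalars ConvSeries ⧸
      LinearMap.range (LinearMap.lsmul ConvSeries (U.restrictScalars ConvSeries) tvar))

end V0

end MeromorphicHiggs

end

noncomputable section

namespace MeromorphicHiggs

/-! Put `T = tθ`. The regular part is the set of vectors killed by some `a(T)` with `a` monic over
`ℂ{t}` (`regPart`). The irregular part is the set of vectors killed by some `b(T)` with `b ≡ 1`
modulo `t` (`irrPart`). By Nakayama such `a` and `b` are coprime in `ℂ{t}[X]`
(`isCoprime_of_monic_of_isOneModT`), so the two parts meet in `0`. They span because the minimal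
polynomial of `T` divides a product `a * b` (`exists_dvd_map_mul`). By Newton–Puiseux each
irreducible factor has a root in some `K_q`, and either this root or its inverse lies in `ℂ{t_q}`.
Newton–Puiseux rests on Hensel's lemma for `ℂ{t}`, which comes from the analytic inverse function
theorem.

Uniqueness: in any polar decomposition, `N 0` lies in the regular part of `t_q θ_q` and the other `N
φ` in its irregular part, since `t_q ∂φ/∂t_q` has a pole for `φ ≠ 0`. The base changes of the two
parts of `T` lie there too. Two complementary pairs inside the same disjoint pair are equal
(`baseChange_eq_of_isPolarDecomposition`), and base change of subspaces is injective. A polar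
decomposition exists: group the generalized eigenspaces of `θ_q` by the polar part of the
eigenvalue.

Dimension: the projection of `U` to the regular part is a `ℂ{t}`-lattice `L`, since `T` is integral
there, and `L` is free of rank `dim_K Mreg`. If `u ∈ U` is irregular, then `b(T) u = 0` with `b = 1
- t c`, so `u = t c(T) u ∈ tU`. Hence `U/tU ≅ L/tL`. -/

open Filter Topology Polynomial

/-! ### Convergent power series as analytic germs; `ℂ{t}` is a discrete valuation ring. -/

/-- The underlying formal power series of a convergent power series. -/
def toPowerSeries : ConvSeries →ₐ[ℂ] PowerSeries ℂ := convergentSeries.val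

lemma toPowerSeries_injective : Function.Injective toPowerSeries := Subtype.val_injective

/-- The constant coefficient, as an algebra homomorphism. -/
def constCoeff : ConvSeries →ₐ[ℂ] ℂ where
  toRingHom := (PowerSeries.constantCoeff (R := ℂ)).comp toPowerSeries.toRingHom
  commutes' c := by
    change PowerSeries.constantCoeff (toPowerSeries (algebraMap ℂ ConvSeries c)) = c
    rw [AlgHom.commutes]; simp

lemma constCoeff_apply (f : ConvSeries) :
    constCoeff f = PowerSeries.coeff 0 (toPowerSeries f) := by
  rw [PowerSeries.coeff_zero_eq_constantCoeff]; rfl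

@[simp] lemma toPowerSeries_tvar : toPowerSeries tvar = PowerSeries.X := rfl

@[simp] lemma constCoeff_tvar : constCoeff tvar = 0 := by
  simp [constCoeff_apply, PowerSeries.coeff_X]

lemma exists_toPowerSeries_eq {f : PowerSeries ℂ} {r : ℝ} (hr : 0 < r)
    (h : Summable fun n => ‖PowerSeries.coeff n f‖ * r ^ n) :
    ∃ g : ConvSeries, toPowerSeries g = f :=
  ⟨(⟨f, r, hr, h⟩ : convergentSeries), rfl⟩

lemma exists_summable (f : ConvSeries) :
    ∃ r : ℝ, 0 < r ∧ Summable fun n => ‖PowerSeries.coeff n (toPowerSeries f)‖ * r ^ n :=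
  f.2

/-- The sum of a convergent power series. -/
def evalAt (f : ConvSeries) (z : ℂ) : ℂ := ∑' n, PowerSeries.coeff n (toPowerSeries f) * z ^ n

lemma eventually_summable (f : ConvSeries) :
    ∀ᶠ z in 𝓝 (0 : ℂ), Summable fun n => ‖PowerSeries.coeff n (toPowerSeries f) * z ^ n‖ := by
  obtain ⟨r, hr, h⟩ := exists_summable f
  filter_upwards [Metric.ball_mem_nhds (0 : ℂ) hr] with z hz
  have := summable_mono (norm_nonneg z) (mem_ball_zero_iff.1 hz).le h
  simpa using this

/-- The germ at the origin of the sum of a convergent power series. -/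
def germ : ConvSeries →+* Germ (𝓝 (0 : ℂ)) ℂ where
  toFun f := ((evalAt f : ℂ → ℂ) : Germ (𝓝 (0 : ℂ)) ℂ)
  map_one' := by
    refine Germ.coe_eq.2 (Eventually.of_forall fun z => ?_)
    simp only [evalAt, map_one, PowerSeries.coeff_one]
    rw [tsum_eq_single 0 (by intro n hn; simp [hn])]
    simp
  map_zero' := by
    refine Germ.coe_eq.2 (Eventually.of_forall fun z => ?_)
    simp [evalAt]
  map_mul' f g := by
    refine Germ.coe_eq.2 ?_
    filter_upwards [eventually_summable f, eventually_summable g] with z hf hg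
    simp only [evalAt]
    rw [tsum_mul_tsum_eq_tsum_sum_antidiagonal_of_summable_norm hf hg]
    refine tsum_congr fun n => ?_
    rw [map_mul, PowerSeries.coeff_mul, Finset.sum_mul]
    refine Finset.sum_congr rfl fun kl hkl => ?_
    rw [← Finset.HasAntidiagonal.mem_antidiagonal.1 hkl, pow_add]
    ring
  map_add' f g := by
    refine Germ.coe_eq.2 ?_
    filter_upwards [eventually_summable f, eventually_summable g] with z hf hg
    simp only [evalAt, map_add, add_mul]
    exact hf.of_norm.tsum_add hg.of_norm

lemma germ_apply (f : ConvSeries) : germ f = ((evalAt f : ℂ → ℂ) : Germ (𝓝 (0 : ℂ)) ℂ) := rfl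

lemma hasFPowerSeriesAt_evalAt (f : ConvSeries) :
    HasFPowerSeriesAt (evalAt f)
      (FormalMultilinearSeries.ofScalars ℂ fun n => PowerSeries.coeff n (toPowerSeries f)) 0 := by
  rw [hasFPowerSeriesAt_iff]
  filter_upwards [eventually_summable f] with z hz
  have := hz.of_norm.hasSum
  simpa [evalAt, FormalMultilinearSeries.coeff_ofScalars, mul_comm] using this

lemma analyticAt_evalAt (f : ConvSeries) : AnalyticAt ℂ (evalAt f) 0 :=
  (hasFPowerSeriesAt_evalAt f).analyticAt

lemma germ_injective : Function.Injective germ := by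
  intro f g h
  have h' : evalAt f =ᶠ[𝓝 0] evalAt g := Germ.coe_eq.1 h
  have := ((hasFPowerSeriesAt_evalAt f).congr h').eq_formalMultilinearSeries
    (hasFPowerSeriesAt_evalAt g)
  refine toPowerSeries_injective (PowerSeries.ext fun n => ?_)
  have := congrArg (fun p => FormalMultilinearSeries.coeff p n) this
  simpa [FormalMultilinearSeries.coeff_ofScalars] using this

/-- Together with `germ_injective`, this lets analytic constructions (inverses, the inverse function
theorem) produce elements of `ℂ{t}`. -/
lemma exists_germ_eq {h : ℂ → ℂ} (hh : AnalyticAt ℂ h 0) :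
    ∃ f : ConvSeries, germ f = (h : Germ (𝓝 (0 : ℂ)) ℂ) := by
  obtain ⟨p, hp⟩ := hh
  obtain ⟨r, hr, hr'⟩ := ENNReal.lt_iff_exists_nnreal_btwn.1 hp.radius_pos
  have hs := p.summable_norm_mul_pow hr'
  obtain ⟨f, hf⟩ := exists_toPowerSeries_eq (f := PowerSeries.mk p.coeff) (r := r)
    (by exact_mod_cast hr) (by
      simpa [← FormalMultilinearSeries.norm_apply_eq_norm_coef] using hs)
  refine ⟨f, Germ.coe_eq.2 ?_⟩
  filter_upwards [hasFPowerSeriesAt_iff.1 hp] with z hz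
  rw [evalAt, hf, ← show _ = h z by simpa using hz.tsum_eq]
  simp [mul_comm]

lemma evalAt_zero (f : ConvSeries) : evalAt f 0 = constCoeff f := by
  rw [evalAt, tsum_eq_single 0 (by intro n hn; simp [hn]), constCoeff_apply]; simp

/-- The inverse series is the Taylor series of the analytic function `1/f`, so no estimate on its
coefficients is needed. -/
lemma isUnit_iff_constCoeff_ne_zero {f : ConvSeries} : IsUnit f ↔ constCoeff f ≠ 0 := by
  refine ⟨fun h => (h.map constCoeff).ne_zero, fun h => ?_⟩
  rw [← evalAt_zero] at h
  obtain ⟨g, hg⟩ := exists_germ_eq ((analyticAt_evalAt f).inv h)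
  refine IsUnit.of_mul_eq_one g (germ_injective ?_)
  rw [map_mul, hg, map_one, germ_apply, ← Germ.coe_mul]
  refine Germ.coe_eq.2 ?_
  filter_upwards [(analyticAt_evalAt f).continuousAt.eventually_ne h] with z hz
  simp [hz]

instance : IsLocalRing ConvSeries :=
  IsLocalRing.of_nonunits_add fun a b ha hb => by
    simp only [mem_nonunits_iff, isUnit_iff_constCoeff_ne_zero, not_not, map_add] at *
    rw [ha, hb, add_zero]

lemma exists_eq_tvar_mul {f : ConvSeries} (hf : constCoeff f = 0) : ∃ g, f = tvar * g := by
  obtain ⟨r, hr, h⟩ := exists_summable f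
  rw [constCoeff_apply] at hf
  obtain ⟨g, hg⟩ := exists_toPowerSeries_eq
    (f := PowerSeries.mk fun n => PowerSeries.coeff (n + 1) (toPowerSeries f)) hr (by
      have := ((summable_nat_add_iff 1).2 h).mul_right r⁻¹
      refine this.congr fun n => ?_
      rw [PowerSeries.coeff_mk, pow_succ]
      field_simp)
  refine ⟨g, toPowerSeries_injective (PowerSeries.ext fun n => ?_)⟩
  rw [map_mul, toPowerSeries_tvar, hg]
  cases n with
  | zero => simpa using hf
  | succ n => simp [PowerSeries.coeff_succ_X_mul]

lemma tvar_dvd_iff {f : ConvSeries} : tvar ∣ f ↔ constCoeff f = 0 := by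
  refine ⟨?_, fun h => exists_eq_tvar_mul h⟩
  rintro ⟨g, rfl⟩
  simp

lemma tvar_ne_zero : tvar ≠ 0 := fun h =>
  PowerSeries.X_ne_zero (R := ℂ) (by rw [← toPowerSeries_tvar, h, map_zero])

lemma prime_tvar : Prime tvar := by
  refine ⟨tvar_ne_zero, by simp [isUnit_iff_constCoeff_ne_zero], fun a b h => ?_⟩
  simpa only [tvar_dvd_iff, map_mul, mul_eq_zero] using h

lemma exists_eq_tvar_pow_mul {f : ConvSeries} (hf : f ≠ 0) :
    ∃ (n : ℕ) (g : ConvSeries), IsUnit g ∧ f = tvar ^ n * g := by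
  -- The induction runs on the index of any nonzero coefficient, which only bounds the order from
  -- above.
  obtain ⟨n, hn⟩ := PowerSeries.exists_coeff_ne_zero_iff_ne_zero.2
    (fun h => hf (toPowerSeries_injective (h.trans (map_zero _).symm)))
  induction n generalizing f with
  | zero =>
    exact ⟨0, f, isUnit_iff_constCoeff_ne_zero.2 (by rwa [constCoeff_apply]), by simp⟩
  | succ n ih =>
    by_cases h0 : constCoeff f = 0
    · obtain ⟨g, rfl⟩ := exists_eq_tvar_mul h0
      obtain ⟨m, k, hk, rfl⟩ := ih (f := g) (right_ne_zero_of_mul hf)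
        (by simpa [PowerSeries.coeff_succ_X_mul] using hn)
      exact ⟨m + 1, k, hk, by ring⟩
    · exact ⟨0, f, isUnit_iff_constCoeff_ne_zero.2 h0, by simp⟩

instance : IsDiscreteValuationRing ConvSeries :=
  IsDiscreteValuationRing.ofHasUnitMulPowIrreducibleFactorization
    ⟨tvar, prime_tvar.irreducible, fun {f} hf => by
      obtain ⟨n, g, hg, rfl⟩ := exists_eq_tvar_pow_mul hf
      exact ⟨n, hg.unit, rfl⟩⟩

lemma maximalIdeal_eq : IsLocalRing.maximalIdeal ConvSeries = Ideal.span {tvar} := by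
  ext f
  rw [IsLocalRing.mem_maximalIdeal, mem_nonunits_iff, isUnit_iff_constCoeff_ne_zero, not_not,
    Ideal.mem_span_singleton, tvar_dvd_iff]

/-! ### Hensel's lemma for `ℂ{t}` through the inverse function theorem. -/

section LowPoly

variable {R : Type*} [CommRing R] (n : ℕ)

/-- The polynomial of degree less than `n` with given coefficients. -/
def lowPoly : (Fin n → R) →ₗ[R] R[X] :=
  (degreeLT R n).subtype ∘ₗ (degreeLTEquiv R n).symm.toLinearMap

variable {n}

lemma degree_lowPoly_lt (u : Fin n → R) : (lowPoly n u).degree < n :=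
  mem_degreeLT.1 ((degreeLTEquiv R n).symm u).2

lemma coeff_lowPoly (u : Fin n → R) (i : ℕ) :
    (lowPoly n u).coeff i = if h : i < n then u ⟨i, h⟩ else 0 := by
  split_ifs with h
  · exact congrFun ((degreeLTEquiv R n).apply_symm_apply u) ⟨i, h⟩
  · exact coeff_eq_zero_of_degree_lt
      ((degree_lowPoly_lt u).trans_le (by exact_mod_cast not_lt.1 h))

lemma lowPoly_injective : Function.Injective (lowPoly (R := R) n) :=
  Subtype.val_injective.comp (degreeLTEquiv R n).symm.injective

lemma monic_X_pow_add_lowPoly (u : Fin n → R) : (X ^ n + lowPoly n u).Monic :=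
  monic_X_pow_add (degree_lowPoly_lt u)

lemma natDegree_X_pow_add_lowPoly [Nontrivial R] (u : Fin n → R) :
    (X ^ n + lowPoly n u).natDegree = n := by
  rw [natDegree_add_eq_left_of_degree_lt, natDegree_X_pow]
  simpa using degree_lowPoly_lt u

lemma _root_.Polynomial.Monic.eq_X_pow_add_lowPoly {p : R[X]} (hp : p.Monic)
    (hn : p.natDegree = n) : p = X ^ n + lowPoly n fun i => p.coeff i := by
  ext i
  rw [coeff_add, coeff_lowPoly, coeff_X_pow]
  rcases lt_trichotomy i n with h | h | h
  · simp [h, h.ne]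
  · subst h; simp [← hn, hp.coeff_natDegree]
  · simp [h.ne', h.not_gt, coeff_eq_zero_of_natDegree_lt (hn.trans_lt h)]

end LowPoly

section Product

variable (m l : ℕ)

/-- The coefficients of the product of two monic polynomials, as a function of their
coefficients. -/
def mulCoeffs (p : (Fin m → ℂ) × (Fin l → ℂ)) : Fin (m + l) → ℂ := fun k =>
  ((X ^ m + lowPoly m p.1) * (X ^ l + lowPoly l p.2)).coeff k

/-- The bilinear part of `mulCoeffs`. -/
def mulBilin : (Fin m → ℂ) →L[ℂ] (Fin l → ℂ) →L[ℂ] (Fin (m + l) → ℂ) :=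
  LinearMap.toContinuousLinearMap ((LinearMap.toContinuousLinearMap (𝕜 := ℂ)).toLinearMap ∘ₗ
    LinearMap.mk₂ ℂ (fun u v k => (lowPoly m u * lowPoly l v).coeff k)
      (fun _ _ _ => by ext; simp [add_mul]) (fun _ _ _ => by ext; simp)
      (fun _ _ _ => by ext; simp [mul_add]) (fun _ _ _ => by ext; simp))

/-- The linear part of `mulCoeffs`. -/
def mulLin : (Fin m → ℂ) × (Fin l → ℂ) →L[ℂ] (Fin (m + l) → ℂ) :=
  LinearMap.toContinuousLinearMap
    { toFun := fun p k => (lowPoly m p.1 * X ^ l + X ^ m * lowPoly l p.2).coeff k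
      map_add' := fun p q => by
        ext k
        simp only [Prod.fst_add, Prod.snd_add, map_add, add_mul, mul_add, coeff_add, Pi.add_apply]
        ring
      map_smul' := fun c p => by
        ext k
        simp only [Prod.smul_fst, Prod.smul_snd, map_smul, smul_mul_assoc, mul_smul_comm,
          ← smul_add, coeff_smul, Pi.smul_apply, RingHom.id_apply] }

lemma mulCoeffs_eq (p : (Fin m → ℂ) × (Fin l → ℂ)) :
    mulCoeffs m l p = mulLin m l p + mulBilin m l p.1 p.2 := by
  ext k
  have hk : ((X : ℂ[X]) ^ m * X ^ l).coeff k = 0 := by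
    rw [← pow_add, coeff_X_pow, if_neg k.2.ne]
  have : (X ^ m + lowPoly m p.1) * (X ^ l + lowPoly l p.2) = X ^ m * X ^ l +
      ((lowPoly m p.1 * X ^ l + X ^ m * lowPoly l p.2) + lowPoly m p.1 * lowPoly l p.2) := by ring
  rw [mulCoeffs, this, coeff_add, hk, zero_add, coeff_add]
  rfl

lemma contDiff_mulCoeffs : ContDiff ℂ ⊤ (mulCoeffs m l) := by
  rw [show mulCoeffs m l = fun p => mulLin m l p + mulBilin m l p.1 p.2 from
    funext (mulCoeffs_eq m l)]
  exact (mulLin m l).contDiff.add (mulBilin m l).isBoundedBilinearMap.contDiff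

variable {m l}

/-- The derivative at `(G, H)` is the Sylvester map `(u, v) ↦ u H + G v`. If this vanishes,
coprimality gives `G ∣ u`, and degrees force `u = 0`, then `v = 0`. Source and target have the same
dimension. -/
lemma exists_equiv_hasFDerivAt_mulCoeffs {p : (Fin m → ℂ) × (Fin l → ℂ)}
    (hp : IsCoprime (X ^ m + lowPoly m p.1) (X ^ l + lowPoly l p.2)) :
    ∃ f : ((Fin m → ℂ) × (Fin l → ℂ)) ≃L[ℂ] (Fin (m + l) → ℂ),
      HasFDerivAt (mulCoeffs m l) (f : ((Fin m → ℂ) × (Fin l → ℂ)) →L[ℂ] (Fin (m + l) → ℂ)) p := by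
  set D : ((Fin m → ℂ) × (Fin l → ℂ)) →L[ℂ] (Fin (m + l) → ℂ) :=
    mulLin m l + (mulBilin m l).isBoundedBilinearMap.deriv p with hD
  have hderiv : HasFDerivAt (mulCoeffs m l) D p := by
    rw [show mulCoeffs m l = fun p => mulLin m l p + mulBilin m l p.1 p.2 from
      funext (mulCoeffs_eq m l)]
    exact (mulLin m l).hasFDerivAt.add ((mulBilin m l).isBoundedBilinearMap.hasFDerivAt p)
  have happ : ∀ w k, D w k = (lowPoly m w.1 * (X ^ l + lowPoly l p.2) +
      (X ^ m + lowPoly m p.1) * lowPoly l w.2).coeff k := by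
    intro w k
    have : lowPoly m w.1 * (X ^ l + lowPoly l p.2) + (X ^ m + lowPoly m p.1) * lowPoly l w.2 =
      (lowPoly m w.1 * X ^ l + X ^ m * lowPoly l w.2) +
        (lowPoly m p.1 * lowPoly l w.2 + lowPoly m w.1 * lowPoly l p.2) := by ring
    rw [this, coeff_add, coeff_add (lowPoly m p.1 * lowPoly l w.2)]
    rfl
  have hinj : Function.Injective D := by
    rw [injective_iff_map_eq_zero]
    intro w hw
    set G := X ^ m + lowPoly m p.1
    set H := X ^ l + lowPoly l p.2
    have hG : G.degree = m := by
      rw [degree_eq_natDegree (monic_X_pow_add_lowPoly p.1).ne_zero, natDegree_X_pow_add_lowPoly]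
    have hH : H.degree = l := by
      rw [degree_eq_natDegree (monic_X_pow_add_lowPoly p.2).ne_zero, natDegree_X_pow_add_lowPoly]
    have hzero : lowPoly m w.1 * H + G * lowPoly l w.2 = 0 := by
      ext k
      by_cases hk : k < m + l
      · rw [← happ w ⟨k, hk⟩, hw]; rfl
      · rw [coeff_zero]
        refine coeff_eq_zero_of_degree_lt (lt_of_lt_of_le ?_
          (show ((m + l : ℕ) : WithBot ℕ) ≤ k by exact_mod_cast not_lt.1 hk))
        refine (degree_add_le _ _).trans_lt (max_lt ?_ ?_)
        · rw [degree_mul, hH, Nat.cast_add]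
          exact WithBot.add_lt_add_right (by simp) (degree_lowPoly_lt w.1)
        · rw [degree_mul, hG, Nat.cast_add]
          exact WithBot.add_lt_add_left (by simp) (degree_lowPoly_lt w.2)
    have h1 : lowPoly m w.1 = 0 := by
      refine eq_zero_of_dvd_of_degree_lt (hp.dvd_of_dvd_mul_right (z := H) ?_)
        (hG ▸ degree_lowPoly_lt w.1)
      exact ⟨-lowPoly l w.2, by linear_combination hzero⟩
    have h2 : lowPoly l w.2 = 0 := by
      rw [h1, zero_mul, zero_add] at hzero
      exact (mul_eq_zero.1 hzero).resolve_left (monic_X_pow_add_lowPoly p.1).ne_zero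
    exact Prod.ext (lowPoly_injective (h1.trans (map_zero _).symm))
      (lowPoly_injective (h2.trans (map_zero _).symm))
  have hfr : Module.finrank ℂ ((Fin m → ℂ) × (Fin l → ℂ)) =
      Module.finrank ℂ (Fin (m + l) → ℂ) := by simp
  refine ⟨(LinearEquiv.ofInjectiveOfFinrankEq D.toLinearMap hinj hfr).toContinuousLinearEquiv, ?_⟩
  convert hderiv using 1
  ext <;> rfl

end Product

lemma germ_coeff_lowPoly {n : ℕ} {u : Fin n → ConvSeries} {U : Fin n → ℂ → ℂ}
    (hu : ∀ i, germ (u i) = (U i : Germ (𝓝 (0 : ℂ)) ℂ)) (i : ℕ) :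
    germ ((X ^ n + lowPoly n u).coeff i) =
      ((fun z => (X ^ n + lowPoly n fun j => U j z).coeff i : ℂ → ℂ) : Germ (𝓝 (0 : ℂ)) ℂ) := by
  simp only [coeff_add, coeff_X_pow, coeff_lowPoly]
  split_ifs with h1 h2 h2
  · exact absurd h2 h1.not_lt
  · simp only [add_zero, map_one]; rfl
  · simp only [zero_add]; exact hu _
  · simp only [add_zero, map_zero]; rfl

/-- Hensel's lemma for `ℂ{t}`: a factorization of a monic polynomial into coprime factors modulo
`t` lifts. -/
theorem exists_mul_of_map_constCoeff_eq_mul {P : ConvSeries[X]} (hP : P.Monic) {g h : ℂ[X]}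
    (hg : g.Monic) (hh : h.Monic) (hgh : IsCoprime g h)
    (hmap : P.map (constCoeff : ConvSeries →+* ℂ) = g * h) :
    ∃ G H : ConvSeries[X], G.Monic ∧ H.Monic ∧ G.natDegree = g.natDegree ∧
      H.natDegree = h.natDegree ∧ P = G * H := by
  set m := g.natDegree with hm
  set l := h.natDegree with hl
  have hdeg : P.natDegree = m + l := by
    rw [← hP.natDegree_map (constCoeff : ConvSeries →+* ℂ), hmap, hg.natDegree_mul hh]
  set p : (Fin m → ℂ) × (Fin l → ℂ) := (fun i => g.coeff i, fun i => h.coeff i) with hp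
  have hg' := hg.eq_X_pow_add_lowPoly hm.symm
  have hh' := hh.eq_X_pow_add_lowPoly hl.symm
  obtain ⟨f, hf⟩ := exists_equiv_hasFDerivAt_mulCoeffs (p := p) (by rwa [← hg', ← hh'])
  have hcd : ContDiffAt ℂ ⊤ (mulCoeffs m l) p := (contDiff_mulCoeffs m l).contDiffAt
  -- The factors at the point `z` are obtained by applying the local inverse of multiplication to
  -- the coefficients of `P` at `z`.
  set ψ := hcd.localInverse hf (by simp) with hψ
  set c : ℂ → Fin (m + l) → ℂ := fun z k => evalAt (P.coeff k) z with hc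
  have hc0 : c 0 = mulCoeffs m l p := by
    ext k
    rw [hc, mulCoeffs, ← hg', ← hh', ← hmap, coeff_map]
    exact evalAt_zero _
  have hcan : AnalyticAt ℂ c 0 := AnalyticAt.pi fun k => analyticAt_evalAt _
  have hψan : AnalyticAt ℂ (fun z => ψ (c z)) 0 := by
    refine AnalyticAt.fun_comp ?_ hcan
    rw [hc0]
    -- Order `⊤` includes analyticity, so the local inverse is analytic and its composite with `c`
    -- has convergent Taylor series.
    exact ContDiffAt.analyticAt (hcd.to_localInverse hf (by simp))
  have hright : ∀ᶠ z in 𝓝 (0 : ℂ), mulCoeffs m l (ψ (c z)) = c z := by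
    have := (hcd.hasStrictFDerivAt' hf (by simp)).eventually_right_inverse
    rw [← hc0] at this
    exact hcan.continuousAt.eventually this
  have hu : ∀ i, AnalyticAt ℂ (fun z => (ψ (c z)).1 i) 0 := fun i =>
    ((ContinuousLinearMap.proj (R := ℂ) (φ := fun _ : Fin m => ℂ) i).comp
      (ContinuousLinearMap.fst ℂ _ _)).analyticAt _ |>.fun_comp hψan
  have hv : ∀ i, AnalyticAt ℂ (fun z => (ψ (c z)).2 i) 0 := fun i =>
    ((ContinuousLinearMap.proj (R := ℂ) (φ := fun _ : Fin l => ℂ) i).comp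
      (ContinuousLinearMap.snd ℂ _ _)).analyticAt _ |>.fun_comp hψan
  choose u hu using fun i => exists_germ_eq (hu i)
  choose v hv using fun i => exists_germ_eq (hv i)
  have hGm := monic_X_pow_add_lowPoly u
  have hHm := monic_X_pow_add_lowPoly v
  have hGd := natDegree_X_pow_add_lowPoly u
  have hHd := natDegree_X_pow_add_lowPoly v
  refine ⟨X ^ m + lowPoly m u, X ^ l + lowPoly l v, hGm, hHm, hGd, hHd, ?_⟩
  rw [hP.eq_X_pow_add_lowPoly hdeg,
    (hGm.mul hHm).eq_X_pow_add_lowPoly (by rw [hGm.natDegree_mul hHm, hGd, hHd])]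
  congr 2
  ext1 k
  refine germ_injective ?_
  rw [coeff_mul, map_sum]
  simp_rw [map_mul, germ_coeff_lowPoly hu, germ_coeff_lowPoly hv]
  rw [germ_apply]
  have : ∀ x : ℕ × ℕ, (((fun z => (X ^ m + lowPoly m fun j => (ψ (c z)).1 j).coeff x.1 : ℂ → ℂ) :
        Germ (𝓝 (0 : ℂ)) ℂ) *
      ((fun z => (X ^ l + lowPoly l fun j => (ψ (c z)).2 j).coeff x.2 : ℂ → ℂ) :
        Germ (𝓝 (0 : ℂ)) ℂ)) = Germ.coeRingHom (𝓝 (0 : ℂ))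
      (fun z => (X ^ m + lowPoly m fun j => (ψ (c z)).1 j).coeff x.1 *
        (X ^ l + lowPoly l fun j => (ψ (c z)).2 j).coeff x.2) := fun x => rfl
  simp_rw [this, ← map_sum]
  refine Germ.coe_eq.2 ?_
  filter_upwards [hright] with z hz
  rw [Finset.sum_apply, ← coeff_mul]
  exact (congrFun hz k).symm

/-! ### Ramification and the Newton–Puiseux theorem. -/

section Ramify

variable (q : ℕ) [NeZero q]

lemma toPowerSeries_ramify (f : ConvSeries) :
    toPowerSeries (ramify q f) = PowerSeries.expand q (NeZero.ne q) (toPowerSeries f) := rfl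

@[simp] lemma ramify_tvar : ramify q tvar = tvar ^ q :=
  toPowerSeries_injective (by
    rw [toPowerSeries_ramify, map_pow, toPowerSeries_tvar, PowerSeries.expand_X])

@[simp] lemma constCoeff_ramify (f : ConvSeries) : constCoeff (ramify q f) = constCoeff f := by
  rw [constCoeff_apply, constCoeff_apply, toPowerSeries_ramify]
  simp

lemma ramify_comp_ramify (r : ℕ) [NeZero r] :
    (ramify q).comp (ramify r) = ramify (q * r) := by
  refine RingHom.ext fun f => toPowerSeries_injective (PowerSeries.ext fun n => ?_)
  rw [RingHom.comp_apply, toPowerSeries_ramify, toPowerSeries_ramify, toPowerSeries_ramify]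
  rw [PowerSeries.expand_mul]

end Ramify

lemma splits_of_map_ramify_left {P : ConvSeries[X]} {q : ℕ} [NeZero q]
    (h : (P.map (ramify q)).Splits) (r : ℕ) [NeZero r] : (P.map (ramify (r * q))).Splits := by
  rw [← ramify_comp_ramify, ← Polynomial.map_map]
  exact h.map _

lemma splits_of_map_ramify_right {P : ConvSeries[X]} {q : ℕ} [NeZero q]
    (h : (P.map (ramify q)).Splits) (r : ℕ) [NeZero r] : (P.map (ramify (q * r))).Splits := by
  simpa only [mul_comm] using splits_of_map_ramify_left h r

/-- A monic polynomial over `ℂ` whose subleading coefficient vanishes is a power of `X` or splits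
into two coprime factors of positive degree. -/
lemma exists_coprime_factors {Q : ℂ[X]} (hQ : Q.Monic) (hdeg : 2 ≤ Q.natDegree)
    (hnext : Q.nextCoeff = 0) (hX : Q ≠ X ^ Q.natDegree) :
    ∃ g h : ℂ[X], g.Monic ∧ h.Monic ∧ IsCoprime g h ∧ Q = g * h ∧
      g.natDegree < Q.natDegree ∧ h.natDegree < Q.natDegree := by
  obtain ⟨c, hc⟩ := IsAlgClosed.exists_root Q
    (by rw [degree_eq_natDegree hQ.ne_zero]; exact_mod_cast (by lia : Q.natDegree ≠ 0))
  obtain ⟨h, hh, hnd⟩ := exists_eq_pow_rootMultiplicity_mul_and_not_dvd Q hQ.ne_zero c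
  set m := Q.rootMultiplicity c
  have hm : 0 < m := (rootMultiplicity_pos hQ.ne_zero).2 hc
  have hg : ((X - C c) ^ m).Monic := (monic_X_sub_C c).pow m
  have hhm : h.Monic := hg.of_mul_monic_left (hh ▸ hQ)
  have hd : Q.natDegree = m + h.natDegree := by
    conv_lhs => rw [hh, hg.natDegree_mul hhm, natDegree_pow, natDegree_X_sub_C, mul_one]
  refine ⟨(X - C c) ^ m, h, hg, hhm, ?_, hh, ?_, by lia⟩
  · exact (((irreducible_X_sub_C c).coprime_iff_not_dvd).2 hnd).pow_left
  · rw [natDegree_pow, natDegree_X_sub_C, mul_one]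
    -- Otherwise `Q = (X - c)^m`, whose subleading coefficient `-m c` vanishes only for `c = 0`, and
    -- then `Q` is a power of `X`.
    by_contra hlt
    have h0 : h = 1 := hhm.natDegree_eq_zero.1 (by lia)
    have hQ' : Q = (X - C c) ^ m := by rw [hh, h0, mul_one]
    rw [hQ', (monic_X_sub_C c).nextCoeff_pow, nextCoeff_X_sub_C, nsmul_eq_mul, mul_neg,
      neg_eq_zero, mul_eq_zero] at hnext
    have hc0 := hnext.resolve_left (by exact_mod_cast hm.ne')
    refine hX ?_
    rw [show Q.natDegree = m by lia, hQ', hc0]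
    simp

/-- First slope of the Newton polygon: with `v j` the order of the coefficient of `X ^ j`, choose
`j₀` minimizing `v j / (n - j)`. After the ramification `q = n - j₀`, the roots can be divided by
`t_q ^ v j₀` with the coefficients staying in `ℂ{t_q}`, and the coefficient of index `j₀` becomes a
unit. -/
lemma exists_tvar_pow_mul_ramify {P : ConvSeries[X]} (hP : P.Monic)
    (hX : P ≠ X ^ P.natDegree) :
    ∃ (q : ℕ) (_ : NeZero q) (k : ℕ) (Q : ConvSeries[X]), Q.Monic ∧ Q.natDegree = P.natDegree ∧
      P.map (ramify q) = Q.scaleRoots (tvar ^ k) ∧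
      Q.map (constCoeff : ConvSeries →+* ℂ) ≠ X ^ P.natDegree := by
  classical
  set n := P.natDegree with hn
  -- For a vanishing coefficient the values are junk; the minimum below is taken over nonvanishing
  -- ones only.
  have hv : ∀ j, ∃ (v : ℕ) (w : ConvSeries), P.coeff j ≠ 0 → IsUnit w ∧
      P.coeff j = tvar ^ v * w := fun j => by
    by_cases h : P.coeff j = 0
    · exact ⟨0, 0, fun h' => absurd h h'⟩
    · obtain ⟨v, w, hw⟩ := exists_eq_tvar_pow_mul h
      exact ⟨v, w, fun _ => hw⟩
  choose v w hvw using hv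
  have hne : ((Finset.range n).filter fun j => P.coeff j ≠ 0).Nonempty := by
    by_contra hemp
    rw [Finset.not_nonempty_iff_eq_empty, Finset.filter_eq_empty_iff] at hemp
    refine hX ?_
    ext j
    rw [coeff_X_pow]
    rcases lt_trichotomy j n with h | h | h
    · simpa [h.ne] using hemp (Finset.mem_range.2 h)
    · rw [if_pos h, h, hn, hP.coeff_natDegree]
    · rw [if_neg h.ne', coeff_eq_zero_of_natDegree_lt h]
  obtain ⟨j₀, hj₀, hmin⟩ := Finset.exists_min_image _
    (fun j => (v j : ℚ) / ((n - j : ℕ) : ℚ)) hne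
  rw [Finset.mem_filter, Finset.mem_range] at hj₀
  have hq : NeZero (n - j₀) := ⟨by lia⟩
  -- Minimality of the slope with denominators cleared: exactly the divisibility needed to define
  -- the coefficients of `Q`.
  have hle : ∀ j < n, P.coeff j ≠ 0 → v j₀ * (n - j) ≤ (n - j₀) * v j := by
    intro j hj hPj
    have := hmin j (Finset.mem_filter.2 ⟨Finset.mem_range.2 hj, hPj⟩)
    rw [div_le_div_iff₀ (by exact_mod_cast (by lia : 0 < n - j₀))
      (by exact_mod_cast (by lia : 0 < n - j))] at this
    rw [mul_comm (n - j₀)]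
    exact_mod_cast this
  have hc : ∀ j : Fin n, ∃ c, ramify (n - j₀) (P.coeff j) = tvar ^ (v j₀ * (n - j)) * c := by
    intro j
    by_cases h : P.coeff j = 0
    · exact ⟨0, by simp [h]⟩
    · rw [(hvw j h).2, map_mul, map_pow, ramify_tvar, ← pow_mul]
      exact (pow_dvd_pow _ (hle j j.2 h)).mul_right _
  choose c hc using hc
  have hQm := monic_X_pow_add_lowPoly c
  have hQd := natDegree_X_pow_add_lowPoly c
  refine ⟨n - j₀, hq, v j₀, X ^ n + lowPoly n c, hQm, hQd, ?_, fun h => ?_⟩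
  · ext1 j
    rw [coeff_map, coeff_scaleRoots, hQd, coeff_add, coeff_lowPoly, coeff_X_pow, ← pow_mul]
    rcases lt_trichotomy j n with h | h | h
    · rw [if_neg h.ne, dif_pos h, zero_add, mul_comm]
      exact hc ⟨j, h⟩
    · have hPn : P.coeff n = 1 := hP.coeff_natDegree
      simp [h, hPn]
    · rw [if_neg h.ne', dif_neg h.not_gt, coeff_eq_zero_of_natDegree_lt h]; simp
  · have h0 := congrArg (fun p => p.coeff j₀) h
    simp only [coeff_map, coeff_add, coeff_X_pow, coeff_lowPoly, if_neg hj₀.1.ne, dif_pos hj₀.1,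
      zero_add] at h0
    have h1 := hc ⟨j₀, hj₀.1⟩
    obtain ⟨hw, hvw'⟩ := hvw j₀ hj₀.2
    dsimp only at h1
    generalize c ⟨j₀, hj₀.1⟩ = c₀ at h0 h1
    rw [hvw', map_mul, map_pow, ramify_tvar, ← pow_mul, mul_comm (n - j₀)] at h1
    have h2 := mul_left_cancel₀ (pow_ne_zero _ tvar_ne_zero) h1
    refine isUnit_iff_constCoeff_ne_zero.1 hw ?_
    rw [← constCoeff_ramify (n - j₀), h2]
    exact h0

/-- This Taylor coefficient is the value at `a` of the Hasse derivative of order `n - 1`, a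
polynomial of degree at most one. It serves the Tschirnhaus shift. -/
lemma coeff_comp_X_add_C {R : Type*} [CommRing R] {P : R[X]} (hP : P.Monic)
    (h1 : 1 ≤ P.natDegree) (a : R) :
    (P.comp (X + C a)).coeff (P.natDegree - 1) =
      P.coeff (P.natDegree - 1) + P.natDegree * a := by
  obtain ⟨n, hn⟩ := Nat.exists_eq_add_of_le' h1
  rw [← taylor_apply, taylor_coeff, hn, Nat.add_sub_cancel,
    eval_eq_sum_range' (n := 2) (by
      have := natDegree_hasseDeriv_le P n
      lia)]
  simp only [Finset.sum_range_succ, Finset.sum_range_zero, hasseDeriv_coeff]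
  rw [zero_add, zero_add, Nat.choose_self, add_comm 1 n, Nat.choose_succ_self_right, ← hn,
    hP.coeff_natDegree]
  simp [hn]

/-- The Newton–Puiseux theorem: a monic polynomial over `ℂ{t}` splits over `ℂ{t_q}` for
some `q`. -/
theorem exists_splits_map_ramify (P : ConvSeries[X]) (hP : P.Monic) :
    ∃ (q : ℕ) (_ : NeZero q), (P.map (ramify q)).Splits := by
  induction hn : P.natDegree using Nat.strong_induction_on generalizing P with
  | _ n ih =>
  rcases Nat.lt_or_ge n 2 with h2 | h2
  · refine ⟨1, inferInstance, Splits.of_natDegree_le_one_of_monic ?_ (hP.map _)⟩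
    rw [hP.natDegree_map]; lia
  -- With zero subleading coefficient, the rescaled `Q` also has zero subleading coefficient and its
  -- reduction is not `X ^ n`. The reduction then has two coprime factors of smaller degree, which
  -- Hensel lifts.
  have reduced : ∀ P : ConvSeries[X], P.Monic → P.natDegree = n → P.coeff (n - 1) = 0 →
      ∃ (q : ℕ) (_ : NeZero q), (P.map (ramify q)).Splits := by
    intro P hP hn h0
    by_cases hX : P = X ^ P.natDegree
    · refine ⟨1, inferInstance, ?_⟩
      rw [hX, Polynomial.map_pow, map_X]
      exact Splits.X_pow _
    obtain ⟨q, hq, k, Q, hQ, hQd, hPQ, hQX⟩ := exists_tvar_pow_mul_ramify hP hX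
    have hQd' := hQ.natDegree_map (constCoeff : ConvSeries →+* ℂ)
    have hQ0 : Q.coeff (n - 1) = 0 := by
      have := congrArg (fun p => p.coeff (n - 1)) hPQ
      simp only [coeff_map, h0, map_zero, coeff_scaleRoots] at this
      exact (mul_eq_zero.1 this.symm).resolve_right
        (pow_ne_zero _ (pow_ne_zero _ tvar_ne_zero))
    obtain ⟨g, h, hg, hh, hgh, hmap, hgd, hhd⟩ := exists_coprime_factors
      (hQ.map (constCoeff : ConvSeries →+* ℂ)) (by lia)
      (by rw [nextCoeff_of_natDegree_pos (by lia), coeff_map, hQd', hQd, hn, hQ0, map_zero])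
      (by rwa [hQd', hQd])
    obtain ⟨G, H, hG, hH, hGd, hHd, hGH⟩ := exists_mul_of_map_constCoeff_eq_mul hQ hg hh hgh hmap
    obtain ⟨q₁, _, h₁⟩ := ih G.natDegree (by lia) G hG rfl
    obtain ⟨q₂, _, h₂⟩ := ih H.natDegree (by lia) H hH rfl
    refine ⟨(q₁ * q₂) * q, inferInstance, ?_⟩
    rw [← ramify_comp_ramify, ← Polynomial.map_map, hPQ,
      map_scaleRoots _ _ _ (by rw [hQ.leadingCoeff, map_one]; exact one_ne_zero), hGH,
      Polynomial.map_mul]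
    exact ((splits_of_map_ramify_right h₁ q₂).mul (splits_of_map_ramify_left h₂ q₁)).scaleRoots _
  -- Tschirnhaus shift: `n a` cancels the subleading coefficient.
  set a : ConvSeries := algebraMap ℂ ConvSeries (-(n : ℂ)⁻¹) * P.coeff (n - 1)
  have hcd : (P.comp (X + C a)).natDegree = n := by
    rw [natDegree_comp, natDegree_X_add_C, mul_one, hn]
  have hc0 : (P.comp (X + C a)).coeff (n - 1) = 0 := by
    have hn0 : (n : ℂ) ≠ 0 := by exact_mod_cast (by lia : n ≠ 0)
    have := coeff_comp_X_add_C hP (by lia) a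
    rw [hn] at this
    rw [this, ← map_natCast (algebraMap ℂ ConvSeries) n, ← mul_assoc, ← map_mul, mul_neg,
      mul_inv_cancel₀ hn0]
    simp
  obtain ⟨q, hq, hs⟩ := reduced _ (hP.comp_X_add_C a) hcd hc0
  refine ⟨q, hq, ?_⟩
  have := hs.comp_X_sub_C (ramify q a)
  rwa [Polynomial.map_comp, Polynomial.map_add, map_X, map_C, comp_assoc, add_comp, X_comp, C_comp,
    sub_add_cancel, comp_X] at this

/-! ### Integrality of `ℂ{t_q}` over `ℂ{t}`. -/

section Integrality

variable (q : ℕ) [NeZero q]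

lemma exists_toPowerSeries_eq_section (f : ConvSeries) (i : ℕ) :
    ∃ g : ConvSeries, toPowerSeries g =
      PowerSeries.mk fun n => PowerSeries.coeff (q * n + i) (toPowerSeries f) := by
  obtain ⟨r, hr, h⟩ := exists_summable f
  refine exists_toPowerSeries_eq (pow_pos hr q) ?_
  have hinj : Function.Injective fun n : ℕ => q * n + i := fun _ _ h =>
    Nat.eq_of_mul_eq_mul_left (NeZero.pos q) (Nat.add_right_cancel h)
  refine ((h.comp_injective hinj).mul_right (r ^ i)⁻¹).congr fun n => ?_
  simp only [Function.comp, PowerSeries.coeff_mk, pow_add, pow_mul]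
  field_simp

/-- Sort the exponents by their residue modulo `q`. -/
lemma exists_eq_sum_tvar_pow_mul_ramify (f : ConvSeries) :
    ∃ g : Fin q → ConvSeries, f = ∑ i : Fin q, tvar ^ (i : ℕ) * ramify q (g i) := by
  choose g hg using exists_toPowerSeries_eq_section q f
  refine ⟨fun i => g i, toPowerSeries_injective (PowerSeries.ext fun n => ?_)⟩
  have hq := NeZero.pos q
  simp only [map_sum, map_mul, map_pow, toPowerSeries_tvar, toPowerSeries_ramify,
    PowerSeries.coeff_X_pow_mul']
  rw [Finset.sum_eq_single ⟨n % q, Nat.mod_lt n hq⟩]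
  · rw [if_pos (Nat.mod_le n q), show n - n % q = q * (n / q) by
      have := Nat.mod_add_div n q; lia, PowerSeries.coeff_expand_mul, hg, PowerSeries.coeff_mk,
      Nat.div_add_mod]
  · intro i _ hi
    split_ifs with hin
    · refine PowerSeries.coeff_expand_of_not_dvd q hq.ne' _ fun ⟨k, hk⟩ => hi (Fin.ext ?_)
      change (i : ℕ) = n % q
      rw [show n = i + q * k by lia, Nat.add_mul_mod_self_left, Nat.mod_eq_of_lt i.2]
    · rfl
  · simp

/-- The powers `t_q ^ i` are integral because `t_q` is a root of `X ^ q - t`, and they generate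
`ℂ{t_q}` over `ℂ{t}`. -/
lemma exists_monic_eval₂_ramify_eq_zero (f : ConvSeries) :
    ∃ a : ConvSeries[X], a.Monic ∧ a.eval₂ (ramify q) f = 0 := by
  change (ramify q).IsIntegralElem f
  have ht : (ramify q).IsIntegralElem tvar :=
    ⟨X ^ q - C tvar, monic_X_pow_sub_C _ (NeZero.ne q), by simp⟩
  have hp : ∀ i : ℕ, (ramify q).IsIntegralElem (tvar ^ i) := fun i => by
    induction i with
    | zero => simpa using (ramify q).isIntegralElem_one
    | succ i ih => rw [pow_succ]; exact ih.mul _ ht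
  obtain ⟨g, hg⟩ := exists_eq_sum_tvar_pow_mul_ramify q f
  rw [hg]
  exact Finset.sum_induction _ _ (fun _ _ h h' => h.add _ h') (ramify q).isIntegralElem_zero
    fun i _ => (hp i).mul _ (ramify q).isIntegralElem_map

end Integrality

/-! ### Polynomials congruent to `1` modulo `t`. -/

section Coprime

/-- A polynomial over `ℂ{t}` congruent to `1` modulo `t`. -/
def IsOneModT (b : ConvSeries[X]) : Prop := b.map (constCoeff : ConvSeries →+* ℂ) = 1

lemma isOneModT_one : IsOneModT 1 := Polynomial.map_one _

lemma IsOneModT.mul {b c : ConvSeries[X]} (hb : IsOneModT b) (hc : IsOneModT c) :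
    IsOneModT (b * c) := by
  unfold IsOneModT at *
  rw [Polynomial.map_mul, hb, hc, mul_one]

lemma IsOneModT.comp {b : ConvSeries[X]} (hb : IsOneModT b) (c : ConvSeries[X]) :
    IsOneModT (b.comp c) := by
  unfold IsOneModT at *
  rw [Polynomial.map_comp, hb, one_comp]

lemma IsOneModT.map_ramify {b : ConvSeries[X]} (hb : IsOneModT b) (q : ℕ) [NeZero q] :
    IsOneModT (b.map (ramify q)) := by
  unfold IsOneModT at *
  rw [Polynomial.map_map, ← hb]
  congr 1
  exact RingHom.ext fun f => constCoeff_ramify q f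

lemma IsOneModT.exists_eq {b : ConvSeries[X]} (hb : IsOneModT b) :
    ∃ c : ConvSeries[X], b = 1 - C tvar * c := by
  have : C tvar ∣ 1 - b := by
    rw [C_dvd_iff_dvd_coeff]
    intro i
    have h := congrArg (fun p => p.coeff i) hb
    simp only [coeff_map] at h
    rw [tvar_dvd_iff, coeff_sub, map_sub, sub_eq_zero]
    refine Eq.trans ?_ h.symm
    rw [coeff_one, coeff_one]; split_ifs <;> simp
  obtain ⟨c, hc⟩ := this
  exact ⟨c, by rw [← hc]; ring⟩

/-- As `a` is monic, `ℂ{t}[X]/(a)` is a finite `ℂ{t}`-module. Modulo `t` the ideal generated by `b`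
is everything, so by Nakayama it is everything. -/
lemma isCoprime_of_monic_of_isOneModT {a b : ConvSeries[X]} (ha : a.Monic) (hb : IsOneModT b) :
    IsCoprime a b := by
  obtain ⟨c, hc⟩ := hb.exists_eq
  have := ha.finite_quotient
  let J := Ideal.span {a}
  let N : Submodule ConvSeries (ConvSeries[X] ⧸ J) :=
    (Ideal.span {Ideal.Quotient.mk J b}).restrictScalars ConvSeries
  have hN : (⊤ : Submodule ConvSeries (ConvSeries[X] ⧸ J)) ≤ N := by
    refine Submodule.le_of_le_smul_of_le_jacobson_bot Module.Finite.fg_top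
      (IsLocalRing.maximalIdeal_le_jacobson _) fun x _ => ?_
    obtain ⟨p, rfl⟩ := Ideal.Quotient.mk_surjective x
    have hp : Ideal.Quotient.mk J p =
        Ideal.Quotient.mk J p * Ideal.Quotient.mk J b + tvar • Ideal.Quotient.mk J (p * c) := by
      have : tvar • Ideal.Quotient.mk J (p * c) = Ideal.Quotient.mk J (tvar • (p * c)) := rfl
      rw [this, ← map_mul, ← map_add, smul_eq_C_mul, hc]
      congr 1; ring
    rw [hp]
    refine Submodule.add_mem_sup ?_ (Submodule.smul_mem_smul ?_ trivial)
    · exact Ideal.mul_mem_left _ _ (Ideal.mem_span_singleton_self _)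
    · rw [maximalIdeal_eq]; exact Ideal.mem_span_singleton_self _
  have h1 : (1 : ConvSeries[X] ⧸ J) ∈ Ideal.span {Ideal.Quotient.mk J b} :=
    hN (Submodule.mem_top (x := (1 : ConvSeries[X] ⧸ J)))
  obtain ⟨s, hs⟩ := Ideal.mem_span_singleton.1 h1
  obtain ⟨p, rfl⟩ := Ideal.Quotient.mk_surjective s
  rw [← map_one (Ideal.Quotient.mk J), ← map_mul, Ideal.Quotient.eq,
    Ideal.mem_span_singleton] at hs
  obtain ⟨r, hr⟩ := hs
  exact ⟨r, p, by linear_combination -hr⟩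

end Coprime

/-! ### Factoring over `K` into an integral part and a part congruent to `1` modulo `t`. -/

section Field

variable {F : Type*} [Field F] [Algebra ConvSeries F] [IsFractionRing ConvSeries F]

lemma algebraMap_tvar_ne_zero : algebraMap ConvSeries F tvar ≠ 0 := by
  simpa using tvar_ne_zero

lemma exists_eq_or_inv_eq_tvar_mul (x : F) :
    (∃ r, x = algebraMap ConvSeries F r) ∨
      x ≠ 0 ∧ ∃ m, x⁻¹ = algebraMap ConvSeries F (tvar * m) := by
  by_cases hx : x = 0
  · exact .inl ⟨0, by simp [hx]⟩
  obtain ⟨r, s, hs, rfl⟩ := IsFractionRing.div_surjective (A := ConvSeries) x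
  have hs0 : s ≠ 0 := nonZeroDivisors.ne_zero hs
  have hr0 : r ≠ 0 := by rintro rfl; simp at hx
  obtain ⟨m, u, hu, rfl⟩ := exists_eq_tvar_pow_mul hr0
  obtain ⟨n, v, hv, rfl⟩ := exists_eq_tvar_pow_mul hs0
  have ht := algebraMap_tvar_ne_zero (F := F)
  obtain ⟨u, rfl⟩ := hu
  obtain ⟨v, rfl⟩ := hv
  have hu' : algebraMap ConvSeries F (u⁻¹ : ConvSeriesˣ) = (algebraMap ConvSeries F u)⁻¹ := by
    refine eq_inv_of_mul_eq_one_left ?_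
    rw [← map_mul, Units.inv_mul, map_one]
  have hv' : algebraMap ConvSeries F (v⁻¹ : ConvSeriesˣ) = (algebraMap ConvSeries F v)⁻¹ := by
    refine eq_inv_of_mul_eq_one_left ?_
    rw [← map_mul, Units.inv_mul, map_one]
  have hu0 : algebraMap ConvSeries F u ≠ 0 := by simp
  have hv0 : algebraMap ConvSeries F v ≠ 0 := by simp
  rcases Nat.lt_or_ge m n with h | h
  · obtain ⟨k, rfl⟩ := Nat.exists_eq_add_of_lt h
    refine .inr ⟨hx, tvar ^ k * v * (u⁻¹ : ConvSeriesˣ), ?_⟩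
    simp only [map_mul, map_pow, hu']
    field_simp
    ring
  · obtain ⟨k, rfl⟩ := Nat.exists_eq_add_of_le h
    refine .inl ⟨tvar ^ k * u * (v⁻¹ : ConvSeriesˣ), ?_⟩
    simp only [map_mul, map_pow, hv']
    field_simp
    ring

end Field

lemma algebraMap_algebraMap (q : ℕ) [NeZero q] (f : ConvSeries) :
    algebraMap ConvLaurent (RamifiedField q) (algebraMap ConvSeries ConvLaurent f) =
      algebraMap ConvSeries (RamifiedField q) (ramify q f) :=
  IsLocalization.map_eq (S := ConvLaurent) (Q := ConvLaurent) (M := nonZeroDivisors ConvSeries)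
    (T := nonZeroDivisors ConvSeries)
    (nonZeroDivisors_le_comap_nonZeroDivisors_of_injective _ (ramify_injective q)) f

lemma algebraMap_comp_algebraMap (q : ℕ) [NeZero q] :
    (algebraMap ConvLaurent (RamifiedField q)).comp (algebraMap ConvSeries ConvLaurent) =
      (algebraMap ConvSeries (RamifiedField q)).comp (ramify q) :=
  RingHom.ext (algebraMap_algebraMap q)

/-- The Newton–Puiseux theorem: a polynomial over `K` splits over `K_q` for some `q`. -/
theorem exists_splits_map_algebraMap (P : ConvLaurent[X]) :
    ∃ (q : ℕ) (_ : NeZero q), (P.map (algebraMap ConvLaurent (RamifiedField q))).Splits := by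
  by_cases hP0 : P = 0
  · exact ⟨1, inferInstance, by simp [hP0]⟩
  have monic : ∀ P : ConvLaurent[X], P.Monic →
      ∃ (q : ℕ) (_ : NeZero q), (P.map (algebraMap ConvLaurent (RamifiedField q))).Splits := by
    intro P hP
    -- Multiplying the roots by a common denominator `d` makes the coefficients integral; the roots
    -- are divided by `d` again at the end.
    set d := IsLocalization.commonDenom (nonZeroDivisors ConvSeries) P.support P.coeff
    have hl := IsLocalization.scaleRoots_commonDenom_mem_lifts (nonZeroDivisors ConvSeries) P
      (by rw [hP.leadingCoeff]; exact ⟨1, map_one _⟩)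
    obtain ⟨Q, hQ, -, hQm⟩ := lifts_and_natDegree_eq_and_monic hl
      ((monic_scaleRoots_iff _).2 hP)
    obtain ⟨q, hq, hs⟩ := exists_splits_map_ramify Q hQm
    refine ⟨q, hq, ?_⟩
    have h1 := hs.map (algebraMap ConvSeries (RamifiedField q))
    rw [Polynomial.map_map, ← algebraMap_comp_algebraMap, ← Polynomial.map_map, hQ] at h1
    have hlead : algebraMap ConvLaurent (RamifiedField q) P.leadingCoeff ≠ 0 := by
      rw [hP.leadingCoeff, map_one]; exact one_ne_zero
    rw [map_scaleRoots _ _ _ hlead] at h1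
    have h2 := h1.scaleRoots
      (algebraMap ConvLaurent (RamifiedField q) (algebraMap ConvSeries ConvLaurent d))⁻¹
    rwa [← scaleRoots_mul, mul_inv_cancel₀ (by simp), scaleRoots_one] at h2
  obtain ⟨q, hq, h⟩ := monic _ (monic_mul_leadingCoeff_inv hP0)
  refine ⟨q, hq, ?_⟩
  rw [Polynomial.map_mul] at h
  refine Splits.of_dvd h ?_ (dvd_mul_right _ _)
  rw [← Polynomial.map_mul]
  exact ((monic_mul_leadingCoeff_inv hP0).map _).ne_zero

/-- Otherwise irreducibility gives a Bézout relation between `P` and `a`, which reads `0 = 1` at the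
common root `x`. -/
lemma dvd_map_of_eval₂_eq_zero {q : ℕ} [NeZero q] {P : ConvLaurent[X]} (hP : Irreducible P)
    {x : RamifiedField q} (hx : P.eval₂ (algebraMap ConvLaurent (RamifiedField q)) x = 0)
    {a : ConvSeries[X]}
    (ha : (a.map (ramify q)).eval₂ (algebraMap ConvSeries (RamifiedField q)) x = 0) :
    P ∣ a.map (algebraMap ConvSeries ConvLaurent) := by
  refine (EuclideanDomain.dvd_or_coprime P _ hP).resolve_right fun ⟨u, v, h⟩ => ?_
  rw [eval₂_map, ← algebraMap_comp_algebraMap, ← eval₂_map] at ha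
  have := congrArg (eval₂ (algebraMap ConvLaurent (RamifiedField q)) x) h
  rw [eval₂_add, eval₂_mul, eval₂_mul, hx, ha, eval₂_one] at this
  simp at this

/-- Scaling the roots by `t` leaves only the leading term modulo `t`, and reversal turns `X ^ n`
into `1`. -/
lemma isOneModT_reverse_scaleRoots {c : ConvSeries[X]} (hc : c.Monic) :
    IsOneModT (c.scaleRoots tvar).reverse := by
  have h1 : (c.scaleRoots tvar).map (constCoeff : ConvSeries →+* ℂ) = X ^ c.natDegree := by
    rw [map_scaleRoots _ _ _ (by rw [hc.leadingCoeff, map_one]; exact one_ne_zero)]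
    have : (constCoeff : ConvSeries →+* ℂ) tvar = 0 := constCoeff_tvar
    rw [this, scaleRoots_zero, hc.natDegree_map, (hc.map _).leadingCoeff, one_smul]
  unfold IsOneModT
  rw [reverse, natDegree_scaleRoots, ← reflect_map, h1, reflect_monomial, revAt_le le_rfl,
    Nat.sub_self, pow_zero]

lemma exists_dvd_map_mul_of_irreducible {P : ConvLaurent[X]} (hP : Irreducible P) :
    ∃ a b : ConvSeries[X], a.Monic ∧ IsOneModT b ∧
      P ∣ (a * b).map (algebraMap ConvSeries ConvLaurent) := by
  obtain ⟨q, hq, hs⟩ := exists_splits_map_algebraMap P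
  obtain ⟨x, hx⟩ := hs.exists_eval_eq_zero (by rw [degree_map]; exact hP.degree_pos.ne')
  rw [eval_map] at hx
  rcases exists_eq_or_inv_eq_tvar_mul (F := RamifiedField q) x with ⟨r, rfl⟩ | ⟨hx0, m, hm⟩
  · obtain ⟨a, ha, hra⟩ := exists_monic_eval₂_ramify_eq_zero q r
    refine ⟨a, 1, ha, isOneModT_one, ?_⟩
    rw [mul_one]
    refine dvd_map_of_eval₂_eq_zero hP hx ?_
    rw [eval₂_at_apply, eval_map, hra, map_zero]
  -- Here `x⁻¹ = t_q m`. Its `q`-th power is `t m ^ q`, so that the scaling factor `t` lies in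
  -- `ℂ{t}`. Scaling `c` by `t` gives a polynomial killing `x⁻¹ ^ q`, its reverse kills `x ^ q`, and
  -- expansion by `q` gives one killing `x`.
  · obtain ⟨c, hc, hmc⟩ := exists_monic_eval₂_ramify_eq_zero q (m ^ q)
    refine ⟨1, expand ConvSeries q (c.scaleRoots tvar).reverse, monic_one, ?_, ?_⟩
    · rw [expand_eq_comp_X_pow]
      exact (isOneModT_reverse_scaleRoots hc).comp _
    rw [one_mul]
    refine dvd_map_of_eval₂_eq_zero hP hx ?_
    have h0 := scaleRoots_eval₂_eq_zero (s := tvar) (ramify q) hmc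
    rw [ramify_tvar, ← mul_pow] at h0
    have h1 := congrArg (algebraMap ConvSeries (RamifiedField q)) h0
    rw [hom_eval₂, map_zero, map_pow, ← hm] at h1
    let _ : Invertible (x⁻¹ ^ q) := invertibleOfNonzero (pow_ne_zero _ (inv_ne_zero hx0))
    rw [← eval₂_reverse_eq_zero_iff, invOf_eq_inv, inv_pow, inv_inv] at h1
    rw [eval₂_map, expand_eq_comp_X_pow, eval₂_comp, eval₂_X_pow, h1]

lemma exists_dvd_map_mul {P : ConvLaurent[X]} (hP : P ≠ 0) :
    ∃ a b : ConvSeries[X], a.Monic ∧ IsOneModT b ∧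
      P ∣ (a * b).map (algebraMap ConvSeries ConvLaurent) := by
  induction P using UniqueFactorizationMonoid.induction_on_prime with
  | h₁ => exact absurd rfl hP
  | h₂ P hu => exact ⟨1, 1, monic_one, isOneModT_one, hu.dvd⟩
  | h₃ P p hP0 hp ih =>
    obtain ⟨a, b, ha, hb, h⟩ := ih hP0
    obtain ⟨a', b', ha', hb', h'⟩ := exists_dvd_map_mul_of_irreducible hp.irreducible
    refine ⟨a' * a, b' * b, ha'.mul ha, hb'.mul hb, ?_⟩
    rw [mul_mul_mul_comm, Polynomial.map_mul]
    exact mul_dvd_mul h' h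

lemma map_aeval_of_intertwine {R V W : Type*} [CommRing R] [AddCommGroup V] [Module R V]
    [AddCommGroup W] [Module R W] (g : V →ₗ[R] W) {S : Module.End R V} {T : Module.End R W}
    (h : ∀ v, g (S v) = T (g v)) (p : R[X]) (v : V) : g (aeval S p v) = aeval T p (g v) := by
  induction p using Polynomial.induction_on' generalizing v with
  | add p q hp hq => simp [hp, hq]
  | monomial n a =>
    induction n generalizing v with
    | zero => simp [Module.algebraMap_end_apply]
    | succ n ih =>
      rw [← monomial_mul_X, map_mul, map_mul, aeval_X, aeval_X, Module.End.mul_apply,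
        Module.End.mul_apply, ih, h]

lemma aeval_smul_scaleRoots {F A : Type*} [Field F] [Ring A] [Algebra F A] (p : F[X]) (s : F)
    (x : A) : aeval (s • x) (p.scaleRoots s) = s ^ p.natDegree • aeval x p := by
  have := scaleRoots_eval₂_mul_of_commute (algebraMap F A) x s (p := p)
    (Algebra.commutes s x) (fun r r' => Algebra.commutes r _)
  rwa [← Algebra.smul_def, ← map_pow, ← Algebra.smul_def] at this

/-! ### Regular and irregular parts of an endomorphism. -/

section Parts

variable {F V : Type*} [Field F] [Algebra ConvSeries F] [AddCommGroup V] [Module F V]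

/-- The evaluation at an endomorphism of polynomials with coefficients in `ℂ{t}`. -/
def evalEnd (T : Module.End F V) : ConvSeries[X] →+* Module.End F V :=
  (aeval T : F[X] →ₐ[F] Module.End F V).toRingHom.comp (mapRingHom (algebraMap ConvSeries F))

lemma evalEnd_apply (T : Module.End F V) (a : ConvSeries[X]) :
    evalEnd T a = aeval T (a.map (algebraMap ConvSeries F)) := rfl

lemma evalEnd_X (T : Module.End F V) : evalEnd T X = T := by rw [evalEnd_apply, map_X, aeval_X]

lemma evalEnd_aeval_comm (T : Module.End F V) (a : ConvSeries[X]) (p : F[X]) (v : V) :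
    evalEnd T a (aeval T p v) = aeval T p (evalEnd T a v) := by
  rw [evalEnd_apply, ← Module.End.mul_apply, ← Module.End.mul_apply, ← map_mul, ← map_mul,
    mul_comm]

lemma evalEnd_comm (T : Module.End F V) (a b : ConvSeries[X]) (v : V) :
    evalEnd T a (evalEnd T b v) = evalEnd T b (evalEnd T a v) := evalEnd_aeval_comm T a _ v

lemma evalEnd_mul_apply (T : Module.End F V) (a b : ConvSeries[X]) (v : V) :
    evalEnd T (a * b) v = evalEnd T a (evalEnd T b v) := by
  rw [map_mul, Module.End.mul_apply]

/-- The vectors on which an endomorphism is integral over `ℂ{t}`. -/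
def regPart (T : Module.End F V) : Submodule F V where
  carrier := {v | ∃ a : ConvSeries[X], a.Monic ∧ evalEnd T a v = 0}
  zero_mem' := ⟨1, monic_one, map_zero _⟩
  add_mem' := by
    rintro v w ⟨a, ha, hv⟩ ⟨b, hb, hw⟩
    refine ⟨a * b, ha.mul hb, ?_⟩
    rw [map_add, evalEnd_mul_apply, evalEnd_mul_apply, hw, evalEnd_comm, hv]
    simp
  smul_mem' := by
    rintro c v ⟨a, ha, hv⟩
    exact ⟨a, ha, by rw [map_smul, hv, smul_zero]⟩

/-- The vectors killed by a polynomial in an endomorphism that is congruent to `1` modulo `t`. -/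
def irrPart (T : Module.End F V) : Submodule F V where
  carrier := {v | ∃ b : ConvSeries[X], IsOneModT b ∧ evalEnd T b v = 0}
  zero_mem' := ⟨1, isOneModT_one, map_zero _⟩
  add_mem' := by
    rintro v w ⟨a, ha, hv⟩ ⟨b, hb, hw⟩
    refine ⟨a * b, ha.mul hb, ?_⟩
    rw [map_add, evalEnd_mul_apply, evalEnd_mul_apply, hw, evalEnd_comm, hv]
    simp
  smul_mem' := by
    rintro c v ⟨a, ha, hv⟩
    exact ⟨a, ha, by rw [map_smul, hv, smul_zero]⟩

variable {T : Module.End F V}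

lemma aeval_mem_regPart {v : V} (hv : v ∈ regPart T) (p : F[X]) : aeval T p v ∈ regPart T := by
  obtain ⟨a, ha, h⟩ := hv
  exact ⟨a, ha, by rw [evalEnd_aeval_comm, h, map_zero]⟩

lemma aeval_mem_irrPart {v : V} (hv : v ∈ irrPart T) (p : F[X]) : aeval T p v ∈ irrPart T := by
  obtain ⟨a, ha, h⟩ := hv
  exact ⟨a, ha, by rw [evalEnd_aeval_comm, h, map_zero]⟩

lemma disjoint_regPart_irrPart : Disjoint (regPart T) (irrPart T) := by
  rw [Submodule.disjoint_def]
  rintro v ⟨a, ha, hav⟩ ⟨b, hb, hbv⟩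
  obtain ⟨x, y, h⟩ := isCoprime_of_monic_of_isOneModT ha hb
  have := congrArg (fun p => evalEnd T p v) h
  simpa [evalEnd_mul_apply, hav, hbv] using this.symm

lemma regPart_le_regPart_smul (c : ConvSeries) :
    regPart T ≤ regPart (algebraMap ConvSeries F c • T) := by
  rintro v ⟨a, ha, h⟩
  refine ⟨a.scaleRoots c, (monic_scaleRoots_iff _).2 ha, ?_⟩
  rw [evalEnd_apply, map_scaleRoots _ _ _ (by rw [ha.leadingCoeff, map_one]; exact one_ne_zero),
    aeval_smul_scaleRoots, LinearMap.smul_apply, ← evalEnd_apply, h, smul_zero]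

/-- The substitution `X ↦ c⁻¹ X` must have coefficients in `ℂ{t}`, hence `c` is a unit here, unlike
in `regPart_le_regPart_smul`. -/
lemma irrPart_le_irrPart_smul {c : ConvSeries} (hc : IsUnit c) :
    irrPart T ≤ irrPart (algebraMap ConvSeries F c • T) := by
  rintro v ⟨b, hb, h⟩
  obtain ⟨d, hd⟩ := hc.exists_left_inv
  refine ⟨b.comp (C d * X), hb.comp _, ?_⟩
  rw [evalEnd_apply, Polynomial.map_comp, aeval_comp, Polynomial.map_mul, map_C, map_X, map_mul,
    aeval_C, aeval_X, ← Algebra.smul_def, smul_smul, ← map_mul, hd, map_one, one_smul,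
    ← evalEnd_apply, h]

/-- Since `u T - 1 = u (T - s)`, the polynomial `a` with roots scaled by `u` kills `v` when
evaluated at `u T - 1`. Modulo `t` that polynomial is `X ^ n` and `u X - 1` is `-1`; the sign `(-1)
^ n` makes the result `1`. -/
lemma mem_irrPart_of_sub {s : F} (hs : s ≠ 0) {u : ConvSeries}
    (hu : s⁻¹ = algebraMap ConvSeries F u) (hu0 : constCoeff u = 0) {a : ConvSeries[X]}
    (ha : a.Monic) {v : V} (hv : evalEnd (T - s • 1) a v = 0) : v ∈ irrPart T := by
  refine ⟨C ((-1) ^ a.natDegree) * (a.scaleRoots u).comp (C u * X - 1), ?_, ?_⟩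
  · unfold IsOneModT
    have hu0' : (constCoeff : ConvSeries →+* ℂ) u = 0 := hu0
    rw [Polynomial.map_mul, map_C, Polynomial.map_comp,
      map_scaleRoots _ _ _ (by rw [ha.leadingCoeff, map_one]; exact one_ne_zero), hu0',
      scaleRoots_zero, ha.natDegree_map, (ha.map _).leadingCoeff, one_smul, X_pow_comp]
    simp only [Polynomial.map_sub, Polynomial.map_mul, map_C, hu0', C_0, zero_mul,
      Polynomial.map_one, zero_sub, map_pow, map_neg, map_one]
    rw [← mul_pow]; simp
  · rw [evalEnd_mul_apply]
    have : evalEnd T ((a.scaleRoots u).comp (C u * X - 1)) v = 0 := by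
      rw [evalEnd_apply, Polynomial.map_comp, aeval_comp,
        map_scaleRoots _ _ _ (by rw [ha.leadingCoeff, map_one]; exact one_ne_zero),
        Polynomial.map_sub, Polynomial.map_mul, map_C, map_X, Polynomial.map_one, map_sub, map_mul,
        aeval_C, aeval_X, map_one, ← Algebra.smul_def,
        show algebraMap ConvSeries F u • T - 1 = algebraMap ConvSeries F u • (T - s • 1) by
          rw [smul_sub, smul_smul, ← hu, inv_mul_cancel₀ hs, one_smul],
        aeval_smul_scaleRoots, LinearMap.smul_apply, ← evalEnd_apply, hv, smul_zero]
    rw [this, map_zero]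

end Parts

section Existence

variable {M : Type*} [AddCommGroup M] [Module ConvLaurent M] [Module.Finite ConvLaurent M]

lemma isCompl_regPart_irrPart (T : Module.End ConvLaurent M) :
    IsCompl (regPart T) (irrPart T) := by
  refine ⟨disjoint_regPart_irrPart, codisjoint_iff.2 (eq_top_iff.2 fun v _ => ?_)⟩
  obtain ⟨a, b, ha, hb, h⟩ := exists_dvd_map_mul
    (minpoly.ne_zero (Algebra.IsIntegral.isIntegral (R := ConvLaurent) T))
  have h0 : evalEnd T (a * b) = 0 := aeval_eq_zero_of_dvd_aeval_eq_zero h (minpoly.aeval _ _)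
  obtain ⟨x, y, hxy⟩ := isCoprime_of_monic_of_isOneModT ha hb
  -- In the Bézout splitting `1 = x a + y b`, the first component is killed by `a(T)` and the second
  -- by `b(T)`, as `(a b)(T) = 0`.
  have hv : v = evalEnd T (y * b) v + evalEnd T (x * a) v := by
    rw [← LinearMap.add_apply, ← map_add, add_comm, hxy, map_one, Module.End.one_apply]
  rw [hv]
  refine Submodule.add_mem_sup ⟨a, ha, ?_⟩ ⟨b, hb, ?_⟩
  · rw [← evalEnd_mul_apply, mul_left_comm, evalEnd_mul_apply, h0]; simp
  · rw [← evalEnd_mul_apply, mul_left_comm, mul_comm b, evalEnd_mul_apply, h0]; simp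

end Existence

/-! ### Compatibility with the pull-back to `K_q`. -/

section BaseChange

variable {M : Type*} [AddCommGroup M] [Module ConvLaurent M] (q : ℕ) [NeZero q]

lemma evalEnd_baseChange (T : Module.End ConvLaurent M) (a : ConvSeries[X]) (v : M) :
    evalEnd (T.baseChange (RamifiedField q)) (a.map (ramify q))
      ((1 : RamifiedField q) ⊗ₜ[ConvLaurent] v) =
    (1 : RamifiedField q) ⊗ₜ[ConvLaurent] evalEnd T a v := by
  rw [evalEnd_apply, Polynomial.map_map, ← algebraMap_comp_algebraMap, ← Polynomial.map_map,
    aeval_map_algebraMap, ← LinearMap.baseChange_tmul, evalEnd_apply]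
  have := aeval_algHom_apply (Module.End.baseChangeHom ConvLaurent (RamifiedField q) M) T
    (a.map (algebraMap ConvSeries ConvLaurent))
  exact congrArg (fun f => f ((1 : RamifiedField q) ⊗ₜ[ConvLaurent] v)) this

lemma baseChange_regPart_le (T : Module.End ConvLaurent M) :
    (regPart T).baseChange (RamifiedField q) ≤ regPart (T.baseChange (RamifiedField q)) := by
  rw [Submodule.baseChange_eq_span, Submodule.span_le]
  rintro _ ⟨v, ⟨a, ha, hv⟩, rfl⟩
  refine ⟨a.map (ramify q), ha.map _, ?_⟩
  exact (evalEnd_baseChange q T a v).trans (by rw [hv, TensorProduct.tmul_zero])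

lemma baseChange_irrPart_le (T : Module.End ConvLaurent M) :
    (irrPart T).baseChange (RamifiedField q) ≤ irrPart (T.baseChange (RamifiedField q)) := by
  rw [Submodule.baseChange_eq_span, Submodule.span_le]
  rintro _ ⟨v, ⟨b, hb, hv⟩, rfl⟩
  refine ⟨b.map (ramify q), hb.map_ramify q, ?_⟩
  exact (evalEnd_baseChange q T b v).trans (by rw [hv, TensorProduct.tmul_zero])

/-- The coordinate `t` as an element of `K`. -/
abbrev tK : ConvLaurent := algebraMap ConvSeries ConvLaurent tvar

/-- As `t_q · q t_q ^ (q - 1) = q t`, the pull-back changes `tθ` only by the factor `q`, a unit of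
`ℂ{t_q}`. -/
lemma tq_smul_pullbackField (θ : Module.End ConvLaurent M) :
    tq q • pullbackField q θ = algebraMap ConvSeries (RamifiedField q) (q : ConvSeries) •
      (tK • θ).baseChange (RamifiedField q) := by
  have h : (tK • θ).baseChange (RamifiedField q) = (tq q) ^ q • θ.baseChange (RamifiedField q) := by
    rw [LinearMap.baseChange_smul, ← algebraMap_smul (RamifiedField q) tK, algebraMap_algebraMap,
      ramify_tvar, map_pow]
    rfl
  rw [h, pullbackField, smul_smul, smul_smul, map_natCast, mul_left_comm,
    mul_pow_sub_one (NeZero.ne q)]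

lemma isUnit_natCast : IsUnit (q : ConvSeries) := by
  rw [isUnit_iff_constCoeff_ne_zero, map_natCast]
  exact_mod_cast NeZero.ne q

lemma baseChange_regPart_le_pullback (θ : Module.End ConvLaurent M) :
    (regPart (tK • θ)).baseChange (RamifiedField q) ≤ regPart (tq q • pullbackField q θ) := by
  rw [tq_smul_pullbackField]
  exact (baseChange_regPart_le q _).trans (regPart_le_regPart_smul _)

lemma baseChange_irrPart_le_pullback (θ : Module.End ConvLaurent M) :
    (irrPart (tK • θ)).baseChange (RamifiedField q) ≤ irrPart (tq q • pullbackField q θ) := by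
  rw [tq_smul_pullbackField]
  exact (baseChange_irrPart_le q _).trans (irrPart_le_irrPart_smul (isUnit_natCast q))

lemma baseChange_sup_eq_top {N N' : Submodule ConvLaurent M} (h : N ⊔ N' = ⊤) :
    N.baseChange (RamifiedField q) ⊔ N'.baseChange (RamifiedField q) = ⊤ := by
  refine eq_top_iff.2 ?_
  rw [← Submodule.baseChange_top, ← h, Submodule.baseChange_eq_span, Submodule.span_le]
  rintro _ ⟨v, hv, rfl⟩
  obtain ⟨x, hx, y, hy, rfl⟩ := Submodule.mem_sup.1 hv
  change (1 : RamifiedField q) ⊗ₜ[ConvLaurent] (x + y) ∈ _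
  rw [TensorProduct.tmul_add]
  exact Submodule.add_mem_sup (Submodule.tmul_mem_baseChange_of_mem _ hx)
    (Submodule.tmul_mem_baseChange_of_mem _ hy)

end BaseChange

/-! ### Regularity in terms of integrality over `ℂ{t}`. -/

section Orbit

variable {F V : Type*} [Field F] [Algebra ConvSeries F] [AddCommGroup V] [Module F V]
  [Module ConvSeries V] [IsScalarTower ConvSeries F V]

lemma evalEnd_C_apply (T : Module.End F V) (c : ConvSeries) (v : V) :
    evalEnd T (C c) v = c • v := by
  rw [evalEnd_apply, map_C, aeval_C, Module.algebraMap_end_apply, algebraMap_smul]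

/-- The map `p ↦ p(T) v`, linear over `ℂ{t}`. -/
def orbitMap (T : Module.End F V) (v : V) : ConvSeries[X] →ₗ[ConvSeries] V where
  toFun p := evalEnd T p v
  map_add' p q := by simp
  map_smul' c p := by
    rw [smul_eq_C_mul, evalEnd_mul_apply, evalEnd_C_apply, RingHom.id_apply]

/-- The `ℂ{t}[T]`-submodule generated by a vector. -/
def orbit (T : Module.End F V) (v : V) : Submodule ConvSeries V :=
  LinearMap.range (orbitMap T v)

variable {T : Module.End F V}

lemma self_mem_orbit (v : V) : v ∈ orbit T v :=
  ⟨1, show evalEnd T 1 v = v by simp⟩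

lemma apply_mem_orbit {v w : V} (hw : w ∈ orbit T v) : T w ∈ orbit T v := by
  obtain ⟨p, rfl⟩ := hw
  exact ⟨X * p, (evalEnd_mul_apply T X p v).trans (by rw [evalEnd_X]; rfl)⟩

/-- Division by the monic polynomial killing `v` leaves only the powers of `T` below its degree. -/
lemma fg_orbit {v : V} (hv : v ∈ regPart T) : (orbit T v).FG := by
  obtain ⟨a, ha, hav⟩ := hv
  have hfg : (degreeLT ConvSeries a.natDegree).FG := by
    have := Module.Finite.equiv (degreeLTEquiv ConvSeries a.natDegree).symm
    exact (Submodule.fg_top _).1 Module.Finite.fg_top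
  have : orbit T v = (degreeLT ConvSeries a.natDegree).map (orbitMap T v) := by
    refine le_antisymm ?_ ?_
    · rintro _ ⟨p, rfl⟩
      refine ⟨p %ₘ a, mem_degreeLT.2 ?_, ?_⟩
      · rw [← degree_eq_natDegree ha.ne_zero]
        exact degree_modByMonic_lt p ha
      · change evalEnd T (p %ₘ a) v = evalEnd T p v
        conv_rhs => rw [← modByMonic_add_div p a, map_add, mul_comm, LinearMap.add_apply,
          evalEnd_mul_apply, hav, map_zero, add_zero]
    · rintro _ ⟨p, -, rfl⟩
      exact ⟨p, rfl⟩
  rw [this]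
  exact hfg.map _

lemma evalEnd_eq_aeval_restrictScalars (a : ConvSeries[X]) (v : V) :
    evalEnd T a v = aeval (T.restrictScalars ConvSeries : Module.End ConvSeries V) a v := by
  induction a using Polynomial.induction_on' generalizing v with
  | add p q hp hq => simp [hp, hq]
  | monomial n a =>
    induction n generalizing v with
    | zero =>
      rw [monomial_zero_left, evalEnd_C_apply, aeval_C, Module.algebraMap_end_apply]
    | succ n ih =>
      rw [← monomial_mul_X, evalEnd_mul_apply, map_mul, aeval_X, Module.End.mul_apply, ih,
        evalEnd_X]
      rfl

variable [IsFractionRing ConvSeries F]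

lemma exists_tvar_pow_mul_eq (x : F) : ∃ (n : ℕ) (r : ConvSeries),
    algebraMap ConvSeries F tvar ^ n * x = algebraMap ConvSeries F r := by
  obtain ⟨r, s, hs, rfl⟩ := IsFractionRing.div_surjective (A := ConvSeries) x
  obtain ⟨n, _, ⟨u, rfl⟩, rfl⟩ := exists_eq_tvar_pow_mul (nonZeroDivisors.ne_zero hs)
  refine ⟨n, r * (u⁻¹ : ConvSeriesˣ), ?_⟩
  have ht := algebraMap_tvar_ne_zero (F := F)
  have hu0 : algebraMap ConvSeries F u ≠ 0 := by simp
  have hu' : algebraMap ConvSeries F (u⁻¹ : ConvSeriesˣ) = (algebraMap ConvSeries F u)⁻¹ := by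
    refine eq_inv_of_mul_eq_one_left ?_
    rw [← map_mul, Units.inv_mul, map_one]
  simp only [map_mul, map_pow, hu']
  field_simp

/-- A submodule containing a spanning set of a vector space generates it after inverting `t`. -/
lemma exists_tvar_pow_smul_mem_of_span {E : Submodule ConvSeries V} {s : Set V}
    (hs : s ⊆ E) {v : V} (hv : v ∈ Submodule.span F s) : ∃ n : ℕ, tvar ^ n • v ∈ E := by
  have up : ∀ {w : V} {n : ℕ} (m : ℕ), tvar ^ n • w ∈ E → tvar ^ (m + n) • w ∈ E :=
    fun m h => by rw [pow_add, mul_smul]; exact E.smul_mem _ h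
  induction hv using Submodule.span_induction with
  | mem x hx => exact ⟨0, by simpa using hs hx⟩
  | zero => exact ⟨0, by simp⟩
  | add x y _ _ hx hy =>
    obtain ⟨m, hm⟩ := hx
    obtain ⟨n, hn⟩ := hy
    refine ⟨n + m, ?_⟩
    rw [smul_add]
    exact E.add_mem (up n hm) (by rw [add_comm]; exact up m hn)
  | smul c x _ hx =>
    obtain ⟨m, hm⟩ := hx
    obtain ⟨n, r, hr⟩ := exists_tvar_pow_mul_eq c
    refine ⟨n + m, ?_⟩
    have : tvar ^ (n + m) • c • x = r • tvar ^ m • x := by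
      rw [← algebraMap_smul F (tvar ^ (n + m)), ← algebraMap_smul F r,
        ← algebraMap_smul F (tvar ^ m), smul_smul, smul_smul, ← hr, map_pow, map_pow, pow_add]
      congr 1; ring
    rw [this]
    exact E.smul_mem _ hm

/-- The sum of the orbits of a finite spanning set is a stable lattice. -/
lemma isRegular_of_regPart_eq_top [Module.Finite F V] {θ : Module.End F V}
    (h : regPart (algebraMap ConvSeries F tvar • θ) = ⊤) : IsRegular θ := by
  set T := algebraMap ConvSeries F tvar • θ with hT
  obtain ⟨s, hs⟩ := Module.Finite.fg_top (R := F) (M := V)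
  refine ⟨⨆ v ∈ s, orbit T v, ⟨?_, fun v => ?_⟩, fun e he => ?_⟩
  · exact Submodule.fg_biSup s _ fun v _ => fg_orbit (h ▸ Submodule.mem_top)
  · refine exists_tvar_pow_smul_mem_of_span (F := F) (s := s) (fun v hv => ?_)
      (hs ▸ Submodule.mem_top)
    exact Submodule.mem_iSup_of_mem v (Submodule.mem_iSup_of_mem hv (self_mem_orbit v))
  · have hTe : tvar • θ e = T e := by rw [hT, LinearMap.smul_apply, algebraMap_smul]
    rw [hTe]
    have : (⨆ v ∈ s, orbit T v) ≤ (⨆ v ∈ s, orbit T v).comap (T.restrictScalars ConvSeries) :=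
      iSup₂_le fun v hv w hw => Submodule.mem_iSup_of_mem v
        (Submodule.mem_iSup_of_mem hv (apply_mem_orbit hw))
    exact this he

/-- Cayley–Hamilton on the lattice gives a monic polynomial in `T` killing it; every vector is a
lattice vector up to a power of `t`, which can be cancelled. -/
lemma regPart_eq_top_of_isRegular {θ : Module.End F V} (h : IsRegular θ) :
    regPart (algebraMap ConvSeries F tvar • θ) = ⊤ := by
  set T := algebraMap ConvSeries F tvar • θ with hT
  obtain ⟨E, ⟨hfg, hE⟩, hθ⟩ := h
  have hTE : ∀ e ∈ E, T.restrictScalars ConvSeries e ∈ E := fun e he => by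
    have hTe : T.restrictScalars ConvSeries e = tvar • θ e := by
      rw [LinearMap.restrictScalars_apply, hT, LinearMap.smul_apply, algebraMap_smul]
    rw [hTe]; exact hθ e he
  have := Module.Finite.iff_fg.2 hfg
  obtain ⟨a, ha, ha0⟩ := LinearMap.exists_monic_and_aeval_eq_zero ConvSeries
    ((T.restrictScalars ConvSeries).restrict hTE)
  refine eq_top_iff.2 fun v _ => ⟨a, ha, ?_⟩
  obtain ⟨n, hn⟩ := hE v
  have h1 := map_aeval_of_intertwine E.subtype
    (S := (T.restrictScalars ConvSeries).restrict hTE) (T := T.restrictScalars ConvSeries)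
    (fun v => rfl) a ⟨_, hn⟩
  rw [ha0, ← evalEnd_eq_aeval_restrictScalars] at h1
  have h2 : evalEnd T a (tvar ^ n • v) = 0 := h1.symm
  rw [← algebraMap_smul F, map_smul] at h2
  exact (smul_eq_zero.1 h2).resolve_left (by simpa using fun h => absurd h tvar_ne_zero)

end Orbit

section Restrict

variable {F V : Type*} [Field F] [Algebra ConvSeries F] [AddCommGroup V] [Module F V]

lemma evalEnd_restrict {T : Module.End F V} {N : Submodule F V} (h : ∀ x ∈ N, T x ∈ N)
    (a : ConvSeries[X]) (v : N) : (evalEnd (T.restrict h) a v : V) = evalEnd T a v :=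
  map_aeval_of_intertwine N.subtype (fun _ => rfl) _ v

variable [IsFractionRing ConvSeries F] [Module ConvSeries V] [IsScalarTower ConvSeries F V]

lemma isRegular_restrict_iff [Module.Finite F V] {θ : Module.End F V} {N : Submodule F V}
    (h : ∀ x ∈ N, θ x ∈ N) :
    IsRegular (θ.restrict h) ↔ N ≤ regPart (algebraMap ConvSeries F tvar • θ) := by
  have h' : ∀ x ∈ N, (algebraMap ConvSeries F tvar • θ) x ∈ N := fun x hx =>
    N.smul_mem _ (h x hx)
  have heq : algebraMap ConvSeries F tvar • θ.restrict h =
    (algebraMap ConvSeries F tvar • θ).restrict h' := rfl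
  constructor
  · intro hr v hv
    have := regPart_eq_top_of_isRegular hr ▸ Submodule.mem_top (x := (⟨v, hv⟩ : N))
    obtain ⟨a, ha, hav⟩ := this
    refine ⟨a, ha, ?_⟩
    rw [heq] at hav
    exact (evalEnd_restrict h' a ⟨v, hv⟩).symm.trans (congrArg Subtype.val hav)
  · intro hN
    refine isRegular_of_regPart_eq_top (eq_top_iff.2 fun v _ => ?_)
    obtain ⟨a, ha, hav⟩ := hN v.2
    exact ⟨a, ha, Subtype.ext (by rw [heq, evalEnd_restrict h', hav]; rfl)⟩

end Restrict

/-! ### Polar parts and their derivatives. -/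

section Polar

variable (q : ℕ)

lemma tq_ne_zero : tq q ≠ 0 := algebraMap_tvar_ne_zero

@[simp] lemma PolarPart.deriv_zero : PolarPart.deriv q 0 = 0 := by simp [PolarPart.deriv]

lemma tq_mul_deriv (φ : PolarPart) :
    tq q * φ.deriv q = -aeval (tq q)⁻¹ (X * derivative (φ : ℂ[X])) := by
  rw [PolarPart.deriv, map_mul, aeval_X]
  have := tq_ne_zero q
  field_simp

/-- Up to sign, `t_q ∂φ/∂t_q` is `Q(t_q⁻¹)` with `Q = X φ'` of degree `d ≥ 1`, that is `t_q ^ (-d)`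
times the reverse of `Q` at `t_q`. The latter is a unit, its constant term being the leading
coefficient of `Q`. -/
lemma tq_mul_deriv_ne_zero_and_inv {φ : PolarPart} (hφ : φ ≠ 0) :
    tq q * φ.deriv q ≠ 0 ∧ ∃ u, (tq q * φ.deriv q)⁻¹ = algebraMap ConvSeries (RamifiedField q) u ∧
      constCoeff u = 0 := by
  set Q := X * derivative (φ : ℂ[X]) with hQ
  have hφ0 : (φ : ℂ[X]) ≠ 0 := fun h => hφ (Subtype.ext h)
  have hd : derivative (φ : ℂ[X]) ≠ 0 := by
    intro h
    -- A zero derivative means a constant, and a nonzero multiple of `X` is not constant.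
    have h1 := derivative_eq_zero.1 h
    obtain ⟨p, hp⟩ := Ideal.mem_span_singleton.1 φ.2
    rw [hp, natDegree_X_mul (by rintro rfl; simp at hp; exact hφ hp)] at h1
    lia
  have hQ0 : Q ≠ 0 := mul_ne_zero X_ne_zero hd
  have hQd : Q.natDegree = (derivative (φ : ℂ[X])).natDegree + 1 := natDegree_X_mul hd
  have ht := tq_ne_zero q
  let _ : Invertible (tq q)⁻¹ := invertibleOfNonzero (inv_ne_zero ht)
  have hrev := eval₂_reverse_mul_pow (algebraMap ℂ (RamifiedField q)) (tq q)⁻¹ Q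
  rw [invOf_eq_inv, inv_inv, ← aeval_def, ← aeval_def] at hrev
  set w := aeval tvar Q.reverse with hw
  have hwu : IsUnit w := by
    rw [isUnit_iff_constCoeff_ne_zero, hw, ← aeval_algHom_apply, constCoeff_tvar,
      ← coeff_zero_eq_aeval_zero, coeff_zero_reverse]
    exact leadingCoeff_ne_zero.2 hQ0
  have hwq : aeval (tq q) Q.reverse = algebraMap ConvSeries (RamifiedField q) w :=
    aeval_algebraMap_apply _ _ _
  obtain ⟨u, hu⟩ := hwu
  have hu0 : algebraMap ConvSeries (RamifiedField q) u ≠ 0 := by simp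
  have hu' : algebraMap ConvSeries (RamifiedField q) (u⁻¹ : ConvSeriesˣ) =
      (algebraMap ConvSeries (RamifiedField q) u)⁻¹ := by
    refine eq_inv_of_mul_eq_one_left ?_
    rw [← map_mul, Units.inv_mul, map_one]
  have hs : tq q * φ.deriv q =
      -(algebraMap ConvSeries (RamifiedField q) u * (tq q)⁻¹ ^ Q.natDegree) := by
    rw [tq_mul_deriv, ← hQ, ← hrev, hwq, hu]
  refine ⟨?_, -(tvar ^ Q.natDegree * (u⁻¹ : ConvSeriesˣ)), ?_, ?_⟩
  · rw [hs]
    exact neg_ne_zero.2 (mul_ne_zero hu0 (pow_ne_zero _ (inv_ne_zero ht)))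
  · rw [hs, map_neg, map_mul, map_pow, hu', inv_neg, mul_inv, inv_pow, inv_inv, mul_comm]
    rfl
  · simp [hQd]

/-- Each polar term of `t_q x` is integrated through `t_q ∂(t_q ^ (-m))/∂t_q = -m t_q ^ (-m)`. A
simple pole of `x` is no obstruction: it contributes to `r`. -/
lemma exists_polarPart (x : RamifiedField q) :
    ∃ (φ : PolarPart) (r : ConvSeries),
      tq q * x = tq q * φ.deriv q + algebraMap ConvSeries (RamifiedField q) r := by
  have key : ∀ (m : ℕ) (f : ConvSeries), ∃ (φ : PolarPart) (r : ConvSeries),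
      algebraMap ConvSeries (RamifiedField q) f * (tq q)⁻¹ ^ m =
        tq q * φ.deriv q + algebraMap ConvSeries (RamifiedField q) r := by
    intro m
    induction m with
    | zero => exact fun f => ⟨0, f, by simp⟩
    | succ m ih =>
      intro f
      obtain ⟨g, hg⟩ := exists_eq_tvar_mul
        (f := f - algebraMap ℂ ConvSeries (constCoeff f)) (by simp)
      obtain ⟨φ, r, h⟩ := ih g
      let c : ℂ := -(constCoeff f / (m + 1))
      let ψ : PolarPart := ⟨C c * X ^ (m + 1), Ideal.mem_span_singleton.2
        ((dvd_pow_self X m.succ_ne_zero).mul_left _)⟩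
      refine ⟨φ + ψ, r, ?_⟩
      have hψ : tq q * ψ.deriv q =
          algebraMap ℂ (RamifiedField q) (constCoeff f) * (tq q)⁻¹ ^ (m + 1) := by
        have hc : -(X * derivative (ψ : ℂ[X])) = C (constCoeff f) * X ^ (m + 1) := by
          have hm : (m + 1 : ℂ) ≠ 0 := by exact_mod_cast m.succ_ne_zero
          simp only [ψ, derivative_C_mul_X_pow, c, Nat.add_sub_cancel]
          push_cast
          rw [neg_mul, div_mul_cancel₀ _ hm, C_neg]
          ring
        rw [tq_mul_deriv, ← map_neg, hc, map_mul, aeval_C, map_pow, aeval_X]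
      have hadd : (φ + ψ).deriv q = φ.deriv q + ψ.deriv q := by
        simp only [PolarPart.deriv, Submodule.coe_add, map_add]
        ring
      have hf : algebraMap ConvSeries (RamifiedField q) f = tq q *
          algebraMap ConvSeries (RamifiedField q) g +
            algebraMap ℂ (RamifiedField q) (constCoeff f) := by
        conv_lhs => rw [sub_eq_iff_eq_add.1 hg, map_add, map_mul, ← IsScalarTower.algebraMap_apply]
        rfl
      rw [hadd, mul_add, add_right_comm, ← h, hψ, hf]
      have ht := tq_ne_zero q
      rw [add_mul, pow_succ]
      field_simp
  obtain ⟨n, r, h⟩ := exists_tvar_pow_mul_eq (F := RamifiedField q) (tq q * x)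
  obtain ⟨φ, s, hs⟩ := key n r
  refine ⟨φ, s, ?_⟩
  rw [← hs, ← h]
  have ht := tq_ne_zero q
  have ht' : algebraMap ConvSeries (RamifiedField q) tvar = tq q := rfl
  rw [ht', mul_right_comm, ← mul_pow, mul_inv_cancel₀ ht, one_pow, one_mul]

end Polar

/-! ### Generalized eigenspaces, polar decompositions and uniqueness. -/

lemma ker_aeval_le_iSup_maxGenEigenspace {F V : Type*} [Field F] [AddCommGroup V] [Module F V]
    (f : Module.End F V) {p : F[X]} (hp : p.Splits) (hp0 : p ≠ 0) :
    LinearMap.ker (aeval f p) ≤ ⨆ μ, f.maxGenEigenspace μ := by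
  induction hn : p.natDegree using Nat.strong_induction_on generalizing p with
  | _ n ih =>
  by_cases hd : p.degree = 0
  · rw [eq_C_of_degree_eq_zero hd] at hp0 ⊢
    intro v hv
    rw [LinearMap.mem_ker, aeval_C, Module.algebraMap_end_apply, smul_eq_zero] at hv
    rw [hv.resolve_left (by simpa using hp0)]
    exact zero_mem _
  obtain ⟨μ, hμ⟩ := hp.exists_eval_eq_zero hd
  obtain ⟨h, hh, hnd⟩ := exists_eq_pow_rootMultiplicity_mul_and_not_dvd p hp0 μ
  have hm : 0 < p.rootMultiplicity μ := (rootMultiplicity_pos hp0).2 hμ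
  set m := p.rootMultiplicity μ
  have hh0 : h ≠ 0 := by rintro rfl; simp at hnd
  have hdeg : p.natDegree = m + h.natDegree := by
    conv_lhs => rw [hh, natDegree_mul (pow_ne_zero _ (X_sub_C_ne_zero μ)) hh0, natDegree_pow,
      natDegree_X_sub_C, mul_one]
  rw [hh, ← sup_ker_aeval_eq_ker_aeval_mul_of_coprime f
    ((((irreducible_X_sub_C μ).coprime_iff_not_dvd).2 hnd).pow_left)]
  refine sup_le ?_ (ih h.natDegree (by lia) (hp.of_dvd hp0 ⟨_, hh.trans (mul_comm _ _)⟩) hh0 rfl)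
  refine le_trans (fun v hv => ?_) (le_iSup _ μ)
  rw [Module.End.mem_maxGenEigenspace]
  refine ⟨m, ?_⟩
  rwa [LinearMap.mem_ker, map_pow, map_sub, aeval_X, aeval_C, Algebra.algebraMap_eq_smul_one] at hv

section End

variable {F V : Type*} [Field F] [AddCommGroup V] [Module F V]

lemma smul_sub_smul_one (c d : F) (f : Module.End F V) :
    c • (f - d • 1) = c • f - (c * d) • 1 := by
  rw [smul_sub, smul_smul]

lemma commute_sub_smul_one (d : F) (f : Module.End F V) : Commute f (f - d • 1) :=
  (Commute.refl f).sub_right ((Commute.one_right f).smul_right _)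

/-- Here `c f - c d = c (f - μ) + r`, so a power of `X - r` does the job. -/
lemma mem_regPart_of_mem_maxGenEigenspace [Algebra ConvSeries F] {c d μ : F} {r : ConvSeries}
    (h : c * μ = c * d + algebraMap ConvSeries F r) {f : Module.End F V} {v : V}
    (hv : v ∈ f.maxGenEigenspace μ) : v ∈ regPart (c • f - (c * d) • 1) := by
  obtain ⟨k, hk⟩ := (Module.End.mem_maxGenEigenspace f μ v).1 hv
  refine ⟨(X - C r) ^ k, (monic_X_sub_C _).pow k, ?_⟩
  have h1 : evalEnd (c • f - (c * d) • 1) (X - C r) = c • (f - μ • 1) := by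
    rw [evalEnd_apply, Polynomial.map_sub, map_X, map_C, map_sub, aeval_X, aeval_C,
      Algebra.algebraMap_eq_smul_one, sub_sub, ← add_smul, ← h, smul_sub_smul_one]
  rw [map_pow, h1, _root_.smul_pow, LinearMap.smul_apply, hk, smul_zero]

lemma iSup_maxGenEigenspace_smul_eq_top {p : F[X]} (hp : p.Splits) (hp0 : p ≠ 0)
    {f : Module.End F V} (hf : aeval f p = 0) (c : F) :
    ⨆ μ, (c • f).maxGenEigenspace μ = ⊤ := by
  refine eq_top_iff.2 (le_trans ?_ (ker_aeval_le_iSup_maxGenEigenspace (c • f) (hp.scaleRoots c)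
    (scaleRoots_ne_zero hp0 _)))
  rw [aeval_smul_scaleRoots, hf, smul_zero, LinearMap.ker_zero]

end End

lemma aeval_tK_smul {M : Type*} [AddCommGroup M] [Module ConvLaurent M]
    (θ : Module.End ConvLaurent M) : aeval (tK • θ) (C tK⁻¹ * X) = θ := by
  rw [map_mul, aeval_C, aeval_X, ← Algebra.smul_def, smul_smul,
    inv_mul_cancel₀ algebraMap_tvar_ne_zero, one_smul]

section Polar

variable {M : Type*} [AddCommGroup M] [Module ConvLaurent M]

lemma tq_smul_twistedField (q : ℕ) [NeZero q] (θ : Module.End ConvLaurent M) (φ : PolarPart) :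
    algebraMap ConvSeries (RamifiedField q) tvar • twistedField q θ φ =
      tq q • pullbackField q θ - (tq q * φ.deriv q) • 1 :=
  smul_sub_smul_one _ _ _

lemma IsPolarDecomposition.isCompl {q : ℕ} [NeZero q] {θ : Module.End ConvLaurent M}
    {N : PolarPart → Submodule (RamifiedField q) (Pullback q M)}
    (h : IsPolarDecomposition q θ N) : IsCompl (N 0) (⨆ φ ≠ 0, N φ) := by
  refine ⟨h.iSupIndep 0, codisjoint_iff.2 ?_⟩
  refine eq_top_iff.2 (h.iSup_eq_top ▸ iSup_le fun φ => ?_)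
  by_cases hφ : φ = 0
  · exact hφ ▸ le_sup_left
  · exact le_sup_of_le_right (le_iSup₂ (f := fun φ _ => N φ) φ hφ)

variable [Module.Finite ConvLaurent M]

lemma IsPolarDecomposition.apply_zero_le {q : ℕ} [NeZero q] {θ : Module.End ConvLaurent M}
    {N : PolarPart → Submodule (RamifiedField q) (Pullback q M)}
    (h : IsPolarDecomposition q θ N) : N 0 ≤ regPart (tq q • pullbackField q θ) := by
  obtain ⟨hs, hr⟩ := h.regular 0
  have := (isRegular_restrict_iff hs).1 hr
  rw [tq_smul_twistedField, PolarPart.deriv_zero, mul_zero, zero_smul] at this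
  exact this.trans (congrArg regPart (sub_zero _)).le

lemma IsPolarDecomposition.iSup_ne_zero_le {q : ℕ} [NeZero q] {θ : Module.End ConvLaurent M}
    {N : PolarPart → Submodule (RamifiedField q) (Pullback q M)}
    (h : IsPolarDecomposition q θ N) : ⨆ φ ≠ 0, N φ ≤ irrPart (tq q • pullbackField q θ) := by
  refine iSup₂_le fun φ hφ v hv => ?_
  obtain ⟨hs, hr⟩ := h.regular φ
  obtain ⟨a, ha, hav⟩ := (isRegular_restrict_iff hs).1 hr hv
  rw [tq_smul_twistedField] at hav
  obtain ⟨hne, u, hu, hu0⟩ := tq_mul_deriv_ne_zero_and_inv q hφ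
  exact mem_irrPart_of_sub hne hu hu0 ha hav

/-- Over a suitable `K_q` the minimal polynomial splits, and `N φ` is the sum of the generalized
eigenspaces of `θ_q` whose eigenvalue has polar class `φ`. -/
lemma exists_isPolarDecomposition (θ : Module.End ConvLaurent M) :
    ∃ (q : ℕ) (_ : NeZero q) (N : PolarPart → Submodule (RamifiedField q) (Pullback q M)),
      IsPolarDecomposition q θ N := by
  have hint := Algebra.IsIntegral.isIntegral (R := ConvLaurent) θ
  obtain ⟨q, hq, hs⟩ := exists_splits_map_algebraMap (minpoly ConvLaurent θ)
  set f := pullbackField q θ with hf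
  have htop : ⨆ μ, f.maxGenEigenspace μ = ⊤ := by
    have h0 : aeval (θ.baseChange (RamifiedField q)) (minpoly ConvLaurent θ) = 0 := by
      have := aeval_algHom_apply (Module.End.baseChangeHom ConvLaurent (RamifiedField q) M) θ
        (minpoly ConvLaurent θ)
      rw [minpoly.aeval, map_zero] at this
      exact this
    exact iSup_maxGenEigenspace_smul_eq_top hs (map_ne_zero (minpoly.ne_zero hint))
      ((aeval_map_algebraMap _ _ _).trans h0) _
  choose cls r hcls using exists_polarPart q
  have hind := f.independent_maxGenEigenspace
  refine ⟨q, hq, fun φ => ⨆ μ ∈ {μ | cls μ = φ}, f.maxGenEigenspace μ, ?_, fun φ => ?_, ?_,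
    fun φ => ?_⟩
  · refine ((WellFoundedGT.finite_ne_bot_of_iSupIndep hind).image cls).subset fun φ hφ => ?_
    by_contra hcon
    refine hφ (iSup₂_eq_bot.2 fun μ hμ => ?_)
    by_contra hne
    exact hcon ⟨μ, hne, hμ⟩
  · refine (hind.disjoint_biSup_biSup (s := {μ | cls μ = φ}) (t := {μ | cls μ ≠ φ}) ?_).mono_right
      (iSup₂_le fun ψ hψ => iSup₂_le fun μ hμ => ?_)
    · exact Set.disjoint_left.2 fun μ h h' => h' h
    · exact le_iSup₂_of_le (f := fun μ _ => f.maxGenEigenspace μ) μ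
        (by rw [Set.mem_ofPred_eq, show cls μ = ψ from hμ]; exact hψ) le_rfl
  · refine eq_top_iff.2 (htop ▸ iSup_le fun μ => ?_)
    exact le_iSup_of_le (cls μ) (le_iSup₂_of_le (f := fun μ _ => f.maxGenEigenspace μ) μ rfl le_rfl)
  · have hstable : ∀ x ∈ ⨆ μ ∈ {μ | cls μ = φ}, f.maxGenEigenspace μ,
        twistedField q θ φ x ∈ ⨆ μ ∈ {μ | cls μ = φ}, f.maxGenEigenspace μ := by
      have : (⨆ μ ∈ {μ | cls μ = φ}, f.maxGenEigenspace μ) ≤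
          (⨆ μ ∈ {μ | cls μ = φ}, f.maxGenEigenspace μ).comap (twistedField q θ φ) := by
        refine iSup₂_le fun μ hμ v hv => ?_
        refine le_iSup₂ (f := fun μ _ => f.maxGenEigenspace μ) μ hμ ?_
        refine Module.End.mapsTo_maxGenEigenspace_of_comm (f := f) (g := twistedField q θ φ) ?_ μ hv
        exact commute_sub_smul_one _ f
      exact this
    refine ⟨hstable, (isRegular_restrict_iff hstable).2 (iSup₂_le fun μ hμ v hv => ?_)⟩
    rw [tq_smul_twistedField]
    exact mem_regPart_of_mem_maxGenEigenspace ((show cls μ = φ from hμ) ▸ hcls μ) hv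

lemma eq_of_isCompl_of_disjoint {α : Type*} [Lattice α] [BoundedOrder α] [IsModularLattice α]
    {a b r i : α} (hab : IsCompl a b) (har : a ≤ r) (hbi : b ≤ i) (hri : Disjoint r i) : a = r :=
  eq_of_le_of_inf_le_of_sup_le har (((hri.mono_right hbi).le_bot).trans bot_le)
    (by rw [hab.sup_eq_top]; exact le_top)

/-- Both pairs are complementary and both lie in the regular and irregular parts of `t_q θ_q`, which
are disjoint; each therefore equals that pair. -/
theorem baseChange_eq_of_isPolarDecomposition {q : ℕ} [NeZero q] {θ : Module.End ConvLaurent M}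
    {N : PolarPart → Submodule (RamifiedField q) (Pullback q M)}
    (h : IsPolarDecomposition q θ N) :
    (regPart (tK • θ)).baseChange (RamifiedField q) = N 0 ∧
      (irrPart (tK • θ)).baseChange (RamifiedField q) = ⨆ φ ≠ 0, N φ := by
  have hr := baseChange_regPart_le_pullback q θ
  have hi := baseChange_irrPart_le_pullback q θ
  have hd : Disjoint (regPart (tq q • pullbackField q θ))
    (irrPart (tq q • pullbackField q θ)) := disjoint_regPart_irrPart
  have hc : IsCompl ((regPart (tK • θ)).baseChange (RamifiedField q))
      ((irrPart (tK • θ)).baseChange (RamifiedField q)) :=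
    ⟨hd.mono hr hi, codisjoint_iff.2
      (baseChange_sup_eq_top q (isCompl_regPart_irrPart (tK • θ)).sup_eq_top)⟩
  exact ⟨(eq_of_isCompl_of_disjoint hc hr hi hd).trans
      (eq_of_isCompl_of_disjoint h.isCompl h.apply_zero_le h.iSup_ne_zero_le hd).symm,
    (eq_of_isCompl_of_disjoint hc.symm hi hr hd.symm).trans
      (eq_of_isCompl_of_disjoint h.isCompl.symm h.iSup_ne_zero_le h.apply_zero_le hd.symm).symm⟩

theorem isRegIrrDecomposition_regPart_irrPart (θ : Module.End ConvLaurent M) :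
    IsRegIrrDecomposition θ (regPart (tK • θ)) (irrPart (tK • θ)) := by
  obtain ⟨q, hq, N, hN⟩ := exists_isPolarDecomposition θ
  refine ⟨fun m hm => ?_, fun m hm => ?_, isCompl_regPart_irrPart _,
    q, hq, N, hN, baseChange_eq_of_isPolarDecomposition hN⟩
  · have := aeval_mem_regPart hm (C tK⁻¹ * X)
    rwa [aeval_tK_smul] at this
  · have := aeval_mem_irrPart hm (C tK⁻¹ * X)
    rwa [aeval_tK_smul] at this

theorem IsRegIrrDecomposition.eq {θ : Module.End ConvLaurent M}
    {Mreg Mirr : Submodule ConvLaurent M} (h : IsRegIrrDecomposition θ Mreg Mirr) :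
    Mreg = regPart (tK • θ) ∧ Mirr = irrPart (tK • θ) := by
  obtain ⟨q, hq, N, hN, hr, hi⟩ := h.ramified
  obtain ⟨hr', hi'⟩ := baseChange_eq_of_isPolarDecomposition hN
  exact ⟨Submodule.baseChange_injective (hr.trans hr'.symm),
    Submodule.baseChange_injective (hi.trans hi'.symm)⟩

end Polar

/-! ### Lattices, the regular projection and the dimension of `U/tU`. -/

section Lattice

variable {F V : Type*} [Field F] [Algebra ConvSeries F] [IsFractionRing ConvSeries F]
  [AddCommGroup V] [Module F V] [Module ConvSeries V] [IsScalarTower ConvSeries F V]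

/-- A finitely generated torsion-free module over the principal ideal domain `ℂ{t}` is free, and its
basis stays a basis over `F`. -/
lemma exists_basis_of_isLattice (F : Type*) [Field F] [Algebra ConvSeries F]
    [IsFractionRing ConvSeries F] [Module F V] [IsScalarTower ConvSeries F V]
    {E : Submodule ConvSeries V} (hE : IsLattice E) :
    Nonempty (Module.Basis (Fin (Module.finrank F V)) ConvSeries E) := by
  have : Module.IsTorsionFree ConvSeries V := Module.IsTorsionFree.trans_faithfulSMul ConvSeries F V
  have := Module.Finite.iff_fg.2 hE.fg
  let b := Module.finBasis ConvSeries E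
  have hli : LinearIndependent F fun i => (b i : V) :=
    (LinearIndependent.iff_fractionRing ConvSeries F).1
      (b.linearIndependent.map' E.subtype E.ker_subtype)
  have hspan : ⊤ ≤ Submodule.span F (Set.range fun i => (b i : V)) := by
    intro v _
    obtain ⟨n, hn⟩ := hE.exists_pow_smul_mem v
    have h1 : tvar ^ n • v ∈ Submodule.span F (Set.range fun i => (b i : V)) := by
      have h2 := congrArg (E.subtype) (b.sum_repr ⟨_, hn⟩)
      rw [map_sum] at h2
      rw [show tvar ^ n • v = E.subtype ⟨_, hn⟩ from rfl, ← h2]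
      refine Submodule.sum_mem _ fun i _ => ?_
      rw [map_smul, ← algebraMap_smul F]
      exact Submodule.smul_mem _ _ (Submodule.subset_span ⟨i, rfl⟩)
    rw [← algebraMap_smul F] at h1
    exact (Submodule.smul_mem_iff _ (by simp [tvar_ne_zero])).1 h1
  have hrank : Module.finrank F V = Module.finrank ConvSeries E := by
    simpa using Module.finrank_eq_card_basis (Module.Basis.mk hli hspan)
  rw [hrank]
  exact ⟨b⟩

end Lattice

section Projection

variable {M : Type*} [AddCommGroup M] [Module ConvLaurent M] {θ : Module.End ConvLaurent M}

/-- The restriction of `tθ` to the regular part. -/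
def regEnd (θ : Module.End ConvLaurent M) : Module.End ConvLaurent (regPart (tK • θ)) :=
  (tK • θ).restrict fun v hv => by
    have := aeval_mem_regPart hv X
    rwa [aeval_X] at this

lemma regPart_regEnd : regPart (regEnd θ) = ⊤ := by
  refine eq_top_iff.2 fun v _ => ?_
  obtain ⟨a, ha, hav⟩ := v.2
  exact ⟨a, ha, Subtype.ext ((evalEnd_restrict _ a v).trans hav)⟩

variable [Module.Finite ConvLaurent M]

/-- The projection onto the regular part. -/
def regProj (θ : Module.End ConvLaurent M) : M →ₗ[ConvLaurent] regPart (tK • θ) :=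
  Submodule.projectionOnto _ _ (isCompl_regPart_irrPart (tK • θ))

lemma regProj_eq_zero_iff {m : M} : regProj θ m = 0 ↔ m ∈ irrPart (tK • θ) :=
  Submodule.projectionOnto_apply_eq_zero_iff _

lemma regProj_coe (m : regPart (tK • θ)) : regProj θ m = m :=
  Submodule.projectionOnto_apply_left _ m

lemma regProj_apply (m : M) : regProj θ ((tK • θ) m) = regEnd θ (regProj θ m) := by
  have hm : m ∈ regPart (tK • θ) ⊔ irrPart (tK • θ) :=
    (isCompl_regPart_irrPart (tK • θ)).sup_eq_top ▸ Submodule.mem_top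
  obtain ⟨r, hr, i, hi, rfl⟩ := Submodule.mem_sup.1 hm
  have h1 : (tK • θ) i ∈ irrPart (tK • θ) := by
    have := aeval_mem_irrPart hi X
    rwa [aeval_X] at this
  rw [map_add, map_add, map_add, regProj_eq_zero_iff.2 h1, regProj_eq_zero_iff.2 hi, add_zero,
    add_zero, regProj_coe ⟨r, hr⟩]
  exact regProj_coe (regEnd θ ⟨r, hr⟩)

lemma regProj_evalEnd (a : ConvSeries[X]) (m : M) :
    regProj θ (evalEnd (tK • θ) a m) = evalEnd (regEnd θ) a (regProj θ m) :=
  map_aeval_of_intertwine (regProj θ) regProj_apply _ m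

end Projection

section V0Lattice

variable {M : Type*} [AddCommGroup M] [Module ConvLaurent M] [Module ConvSeries M]
  [IsScalarTower ConvSeries ConvLaurent M] {θ : Module.End ConvLaurent M}

lemma evalEnd_eq_aeval (a : ConvSeries[X]) :
    evalEnd (tK • θ) a = aeval (tvar • θ) a := by
  rw [evalEnd_apply, aeval_map_algebraMap, algebraMap_smul]

lemma evalEnd_mem {U : Submodule (V0 θ) M} (a : ConvSeries[X]) {u : M} (hu : u ∈ U) :
    evalEnd (tK • θ) a u ∈ U := by
  rw [evalEnd_eq_aeval]
  exact U.smul_mem ⟨aeval (tvar • θ) a, aeval_mem_adjoin_singleton _ _⟩ hu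

lemma exists_smul_eq_evalEnd (s : V0 θ) : ∃ a : ConvSeries[X], ∀ m : M,
    s • m = evalEnd (tK • θ) a m := by
  have : (s : Module.End ConvLaurent M) ∈ Algebra.adjoin ConvSeries {tvar • θ} := s.2
  rw [Algebra.adjoin_singleton_eq_range_aeval] at this
  obtain ⟨a, ha⟩ := this
  refine ⟨a, fun m => ?_⟩
  rw [evalEnd_eq_aeval]
  exact (congrArg (fun f : Module.End ConvLaurent M => f m) ha).symm

/-- Writing `b = 1 - t c`, the relation `b(T) u = 0` reads `u = t c(T) u`, and `U` is stable under
`c(T)`. So the irregular part contributes nothing to `U/tU`. -/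
lemma exists_tvar_smul_eq_of_mem_irrPart {U : Submodule (V0 θ) M} {u : M} (hu : u ∈ U)
    (hi : u ∈ irrPart (tK • θ)) : ∃ w ∈ U, u = tvar • w := by
  obtain ⟨b, hb, hbu⟩ := hi
  obtain ⟨c, rfl⟩ := hb.exists_eq
  refine ⟨_, evalEnd_mem c hu, ?_⟩
  rwa [map_sub, map_one, LinearMap.sub_apply, Module.End.one_apply, evalEnd_mul_apply,
    evalEnd_C_apply, sub_eq_zero] at hbu

variable [Module.Finite ConvLaurent M]

/-- The image of a `V₀`-lattice in the regular part. -/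
def regImage (θ : Module.End ConvLaurent M) (U : Submodule (V0 θ) M) :
    Submodule ConvSeries (regPart (tK • θ)) :=
  (U.restrictScalars ConvSeries).map ((regProj θ).restrictScalars ConvSeries)

/-- The image is the sum of the orbits of the projected `V₀`-generators, and these are finite over
`ℂ{t}` because `tθ` is integral on the regular part. -/
lemma isLattice_regImage {U : Submodule (V0 θ) M} (hU : IsV0Lattice θ U) :
    IsLattice (regImage θ U) := by
  refine ⟨?_, fun v => ?_⟩
  · obtain ⟨s, hs⟩ := hU.fg
    have heq : regImage θ U = ⨆ m ∈ s, orbit (regEnd θ) (regProj θ m) := by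
      refine le_antisymm ?_ (iSup₂_le fun m hm w hw => ?_)
      · rintro _ ⟨u, hu, rfl⟩
        have hu' : u ∈ Submodule.span (V0 θ) (s : Set M) := hs ▸ hu
        change regProj θ u ∈ _
        clear hu
        induction hu' using Submodule.span_induction with
        | mem x hx =>
          exact Submodule.mem_iSup_of_mem x (Submodule.mem_iSup_of_mem hx (self_mem_orbit _))
        | zero => rw [map_zero]; exact zero_mem _
        | add x y _ _ hx hy => rw [map_add]; exact add_mem hx hy
        | smul c x _ hx =>
          obtain ⟨a, ha⟩ := exists_smul_eq_evalEnd c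
          rw [ha, regProj_evalEnd]
          have hle : (⨆ m ∈ s, orbit (regEnd θ) (regProj θ m)) ≤
              (⨆ m ∈ s, orbit (regEnd θ) (regProj θ m)).comap
                ((evalEnd (regEnd θ) a).restrictScalars ConvSeries) := by
            refine iSup₂_le fun m hm w hw => ?_
            obtain ⟨p, rfl⟩ := hw
            exact Submodule.mem_iSup_of_mem m (Submodule.mem_iSup_of_mem hm
              ⟨a * p, evalEnd_mul_apply _ _ _ _⟩)
          exact hle hx
      · obtain ⟨p, rfl⟩ := hw
        refine ⟨evalEnd (tK • θ) p m, evalEnd_mem p ?_, regProj_evalEnd p m⟩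
        rw [← hs]
        exact Submodule.subset_span hm
    rw [heq]
    exact Submodule.fg_biSup s _ fun m _ => fg_orbit
      ((regPart_regEnd (θ := θ)).symm ▸ Submodule.mem_top)
  · obtain ⟨n, hn⟩ := hU.exists_pow_smul_mem v
    refine ⟨n, tvar ^ n • (v : M), hn, ?_⟩
    rw [map_smul]
    exact congrArg _ (regProj_coe v)

/-- The action of `ℂ{t}` on `ℂ` through the constant coefficient. -/
abbrev constCoeffAlgebra : Algebra ConvSeries ℂ := (constCoeff : ConvSeries →+* ℂ).toAlgebra

attribute [local instance] constCoeffAlgebra in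
-- The isomorphism is induced by taking coordinates of the regular projection in a basis of the
-- image lattice and reducing them modulo `t`.
lemma nonempty_v0Quotient_equiv {U : Submodule (V0 θ) M} (hU : IsV0Lattice θ U) :
    Nonempty (V0Quotient θ U ≃ₗ[ℂ]
      (Fin (Module.finrank ConvLaurent (regPart (tK • θ))) → ℂ)) := by
  obtain ⟨b⟩ := exists_basis_of_isLattice ConvLaurent (isLattice_regImage hU)
  have hsmul : ∀ (f : ConvSeries) (z : ℂ), f • z = constCoeff f * z := fun _ _ => rfl
  let π : U.restrictScalars ConvSeries →ₗ[ConvSeries] regImage θ U :=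
    ((regProj θ).restrictScalars ConvSeries).submoduleMap (U.restrictScalars ConvSeries)
  have hπ : Function.Surjective π := LinearMap.submoduleMap_surjective _ _
  let red : (Fin (Module.finrank ConvLaurent (regPart (tK • θ))) → ConvSeries) →ₗ[ConvSeries]
      (Fin (Module.finrank ConvLaurent (regPart (tK • θ))) → ℂ) :=
    (Algebra.linearMap ConvSeries ℂ).compLeft _
  have hred : ∀ x i, red x i = constCoeff (x i) := fun _ _ => rfl
  let g := red ∘ₗ b.equivFun.toLinearMap ∘ₗ π
  have hg : Function.Surjective g := by
    refine Function.Surjective.comp (g := red) (fun z => ?_)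
      (b.equivFun.surjective.comp hπ)
    exact ⟨fun i => algebraMap ℂ ConvSeries (z i), funext fun i => by rw [hred]; simp⟩
  have hker : LinearMap.ker g =
      LinearMap.range (LinearMap.lsmul ConvSeries (U.restrictScalars ConvSeries) tvar) := by
    refine le_antisymm (fun u hu => ?_) ?_
    · have hu' : ∀ i, constCoeff (b.equivFun (π u) i) = 0 := fun i => congrFun hu i
      -- The coordinates of `u` are divisible by `t`; lifting the quotients to `w ∈ U` makes `u - t
      -- w` irregular, hence an element of `tU`.
      choose c hc using fun i => exists_eq_tvar_mul (hu' i)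
      obtain ⟨w, hw⟩ := hπ (b.equivFun.symm c)
      have hu2 : π (u - tvar • w) = 0 := by
        rw [map_sub, map_smul, hw, ← map_smul, sub_eq_zero, LinearEquiv.eq_symm_apply]
        exact funext hc
      have hirr : (u - tvar • w : U.restrictScalars ConvSeries).1 ∈ irrPart (tK • θ) :=
        regProj_eq_zero_iff.1 (congrArg Subtype.val hu2)
      obtain ⟨x, hx, hxu⟩ := exists_tvar_smul_eq_of_mem_irrPart
        (U := U) (u - tvar • w : U.restrictScalars ConvSeries).2 hirr
      refine ⟨w + ⟨x, hx⟩, Subtype.ext ?_⟩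
      change tvar • ((w : M) + x) = u
      rw [smul_add, ← hxu]
      change tvar • (w : M) + ((u : M) - tvar • (w : M)) = u
      abel
    · rintro _ ⟨u, rfl⟩
      rw [LinearMap.mem_ker, LinearMap.lsmul_apply, map_smul]
      ext i
      rw [Pi.smul_apply, hsmul]
      simp
  let e := (Submodule.quotEquivOfEq _ _ hker.symm).trans (g.quotKerEquivOfSurjective hg)
  -- `e` is linear over `ℂ{t}`; restricting to constant series gives linearity over `ℂ`.
  exact ⟨{ e with
    map_smul' := fun c x => by
      have h := e.map_smul (algebraMap ℂ ConvSeries c) x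
      refine h.trans (funext fun i => ?_)
      rw [Pi.smul_apply, hsmul, AlgHom.commutes]
      rfl }⟩

end V0Lattice

end MeromorphicHiggs
end

theorem mainTheorem9 {M : Type*} [AddCommGroup M] [Module MeromorphicHiggs.ConvLaurent M]
    [Module.Finite MeromorphicHiggs.ConvLaurent M]
    [Module MeromorphicHiggs.ConvSeries M]
    [IsScalarTower MeromorphicHiggs.ConvSeries MeromorphicHiggs.ConvLaurent M]
    (θ : Module.End MeromorphicHiggs.ConvLaurent M) :
    (∃! P : Submodule MeromorphicHiggs.ConvLaurent M × Submodule MeromorphicHiggs.ConvLaurent M,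
      MeromorphicHiggs.IsRegIrrDecomposition θ P.1 P.2) ∧
    ∀ Mreg Mirr : Submodule MeromorphicHiggs.ConvLaurent M,
      MeromorphicHiggs.IsRegIrrDecomposition θ Mreg Mirr →
      ∀ U : Submodule (MeromorphicHiggs.V0 θ) M, MeromorphicHiggs.IsV0Lattice θ U →
        Module.Finite ℂ (MeromorphicHiggs.V0Quotient θ U) ∧
        Module.finrank ℂ (MeromorphicHiggs.V0Quotient θ U) =
          Module.finrank MeromorphicHiggs.ConvLaurent Mreg := by
  refine ⟨⟨(MeromorphicHiggs.regPart (MeromorphicHiggs.tK • θ),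
    MeromorphicHiggs.irrPart (MeromorphicHiggs.tK • θ)),
    MeromorphicHiggs.isRegIrrDecomposition_regPart_irrPart θ, fun P hP => ?_⟩,
    fun Mreg Mirr h U hU => ?_⟩
  · exact Prod.ext hP.eq.1 hP.eq.2
  · obtain ⟨e⟩ := MeromorphicHiggs.nonempty_v0Quotient_equiv hU
    refine ⟨Module.Finite.equiv e.symm, ?_⟩
    rw [e.finrank_eq, Module.finrank_fin_fun, h.eq.1]
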